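/- Let $d\ge 1$, let $\mathcal H=\ell^2(\mathbb Z^d)$ with canonical basis $(\varphi_k)_{k\in\mathbb Z^d}$, let $X\subset\mathbb R$ carry a probability distribution $\mu$, and let $\Omega=X^{\mathbb Z^d}$ with the cylinder $\sigma$-algebra and $\mathbb P=\bigotimes_{k\in\mathbb Z^d}\mu$. For $j\in\mathbb Z^d$ let $(S_j\omega)_k=\omega_{k+j}$ and let $V_j$ be the unitary operator with $V_j\varphi_k=\varphi_{k-j}$. Let $\gamma_1,\dots,\gamma_d\in\mathbb Z^d$ be linearly independent over $\mathbb{R}$, let $\Gamma$ be the lattice they span, and let $B=\{\sum_i x_i\gamma_i : 0\le x_i<1\}\cap\mathbb Z^d$ be its primitive cell. For $n\in\mathbb N$ put $$\Lambda_n=\bigcup_{-n\le n_1,\dots,n_d\le n}\Big(B+\sum_{i=1}^d n_i\gamma_i\Big),$$ and let $P_{\Lambda_n}$ be the orthogonal projection onto $\mathrm{span}\{\varphi_j: j\in\Lambda_n\}$. A contraction $T$ on $\mathcal H$ is completely non unitary (cnu) if $\psi=0$ is the only vector with $\|T^n\psi\|=\|\psi\|=\|T^{*n}\psi\|$ for all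 $n\in\mathbb N$. Let $A(\mathbb D)$ be the set of continuous functions on $\overline{\mathbb D}$ that are holomorphic on the open unit disk $\mathbb D$. For $f\in A(\mathbb D)$ with $f(z)=\sum_{n\ge0}c_nz^n$ on $\mathbb D$, let $f(T)$ be the strong limit, as $r\to1^-$, of $\sum_{n\ge0}c_nr^nT^n$. Let $\omega\mapsto T_\omega$ be a family of contractions on $\mathcal H$, $\omega\in\Omega$, such that $\omega\mapsto\langle\varphi,T_\omega\psi\rangle$ is measurable for all $\varphi,\psi\in\mathcal H$, $T_\omega$ is cnu for almost every $\omega$, and $$T_{S_g\omega}=V_gT_\omega V_g^{-1}\qquad\text{for all } g\in\Gamma,\ \omega\in\Omega.$$ Then, for all $f\in A(\mathbb D)$ and $b\in B$, the function $\omega\mapsto\langle\varphi_b,f(T_\omega)\varphi_b\rangle$ is integrable, so that the DOS functional $$L(f)=\frac1{|B|}\sum_{b\in B}\mathbb E\big(\langle\varphi_b,f(T_\omega)\varphi_b\rangle\big)$$ is well defined on $A(\mathbb D)$. Moreover, there is a set $\Omega_0\subset\Omega$ of probability one such that for all $\omega\in\Omega_0$ and all $f\in A(\mathbb D)$ the strong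 limit $f(T_\omega)$ exists and $$\lim_{n\to\infty}\frac1{|\Lambda_n|}\,\mathrm{tr}\big(P_{\Lambda_n}f(T_\omega)P_{\Lambda_n}\big)=L(f).$$ -/

import Mathlib

open MeasureTheory Filter Topology

noncomputable section

namespace RandomContraction

/-- The lattice `ℤ^d`. -/
abbrev Lattice (d : ℕ) : Type := Fin d → ℤ

/-- The Hilbert space `ℓ²(ℤ^d)`. -/
abbrev HSpace (d : ℕ) : Type := lp (fun _ : Lattice d => ℂ) 2

/-- The bounded operators on `ℓ²(ℤ^d)`. -/
abbrev Op (d : ℕ) : Type := HSpace d →L[ℂ] HSpace d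

/-- The canonical basis vectors `φ_k` of `ℓ²(ℤ^d)`. -/
def basisVec {d : ℕ} (k : Lattice d) : HSpace d := lp.single 2 k (1 : ℂ)

/-! ### Holomorphic functional calculus -/

/-- A contraction is completely non unitary when the subspace of all `ψ` with
`‖T^n ψ‖ = ‖ψ‖ = ‖T^{*n} ψ‖` for every `n` is trivial. -/
def IsCNU {d : ℕ} (T : Op d) : Prop :=
  ∀ ψ : HSpace d,
    (∀ n : ℕ, ‖(T ^ n) ψ‖ = ‖ψ‖ ∧ ‖(ContinuousLinearMap.adjoint T ^ n) ψ‖ = ‖ψ‖) → ψ = 0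

/-- The disk algebra `A(𝔻)`: continuous on the closed unit disk, holomorphic in the open one.
Only the values on the closed disk matter. -/
def diskAlgebra : Set (ℂ → ℂ) :=
  {f | ContinuousOn f (Metric.closedBall 0 1) ∧ DifferentiableOn ℂ f (Metric.ball 0 1)}

/-- The Taylor coefficients `c_n` of `f` at `0`. -/
def taylorCoeff (f : ℂ → ℂ) (n : ℕ) : ℂ := iteratedDeriv n f 0 / (n.factorial : ℂ)

/-- The operator `f_r(T) = ∑ c_n r^n T^n` (a norm convergent series for `0 < r < 1`). -/
def dilatedCalc {d : ℕ} (f : ℂ → ℂ) (r : ℝ) (T : Op d) : Op d :=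
  ∑' n : ℕ, (taylorCoeff f n * (r : ℂ) ^ n) • T ^ n

/-- `A` is the strong limit of `f_r(T)` as `r → 1⁻`. -/
def IsCalcLimit {d : ℕ} (f : ℂ → ℂ) (T A : Op d) : Prop :=
  ∀ ψ : HSpace d, Tendsto (fun r : ℝ => dilatedCalc f r T ψ) (𝓝[<] 1) (𝓝 (A ψ))

open Classical in
/-- The operator `f(T)`: the strong limit of `f_r(T)` as `r → 1⁻`. -/
def holCalc {d : ℕ} (f : ℂ → ℂ) (T : Op d) : Op d :=
  if h : ∃ A : Op d, IsCalcLimit f T A then h.choose else 0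

/-! ### Shifts -/

/-- The shift `(S_j ω)_k = ω_{k+j}` on `X^{ℤ^d}`. -/
def shift {d : ℕ} {X : Type*} (j : Lattice d) (ω : Lattice d → X) : Lattice d → X :=
  fun k => ω (k + j)

theorem memℓp_translate {d : ℕ} (j : Lattice d) (ψ : HSpace d) :
    Memℓp (fun k : Lattice d => (ψ (k + j) : ℂ)) 2 := by
  have h := lp.memℓp ψ
  rw [memℓp_gen_iff (by norm_num)] at h ⊢
  exact (Equiv.addRight j).summable_iff.mpr h

/-- The unitary `V_j` on `ℓ²(ℤ^d)`, given by `(V_j ψ)(k) = ψ(k + j)`. -/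
def translation {d : ℕ} (j : Lattice d) : HSpace d ≃ₗᵢ[ℂ] HSpace d where
  toFun ψ := ⟨fun k => ψ (k + j), memℓp_translate j ψ⟩
  invFun ψ := ⟨fun k => ψ (k + -j), memℓp_translate (-j) ψ⟩
  map_add' _ _ := rfl
  map_smul' _ _ := rfl
  left_inv ψ := by
    apply Subtype.ext
    funext k
    exact congrArg _ (by abel : k + -j + j = k)
  right_inv ψ := by
    apply Subtype.ext
    funext k
    exact congrArg _ (by abel : k + j + -j = k)
  norm_map' ψ := by
    rw [lp.norm_eq_tsum_rpow (by norm_num), lp.norm_eq_tsum_rpow (by norm_num)]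
    congr 1
    exact (Equiv.addRight j).tsum_eq (fun k => ‖(ψ k : ℂ)‖ ^ (2 : ENNReal).toReal)

/-- `V_j φ_k = φ_{k-j}`. -/
theorem translation_basisVec {d : ℕ} (j k : Lattice d) :
    translation j (basisVec k) = basisVec (k - j) := by
  apply Subtype.ext
  funext m
  change (basisVec k : HSpace d) (m + j) = (basisVec (k - j) : HSpace d) m
  simp only [basisVec, lp.single_apply, Pi.single_apply, eq_sub_iff_add_eq]

/-! ### Period lattice, primitive cell and boxes -/

/-- The period lattice `Γ` spanned by the `γ_i`. -/
def periodLattice {d : ℕ} (γ : Fin d → Lattice d) : AddSubgroup (Lattice d) :=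
  AddSubgroup.closure (Set.range γ)

/-- The primitive cell `B = {∑ x_i γ_i, 0 ≤ x_i < 1} ∩ ℤ^d`, as a set. -/
def cellSet {d : ℕ} (γ : Fin d → Lattice d) : Set (Lattice d) :=
  {b | ∃ x : Fin d → ℝ, (∀ i, 0 ≤ x i ∧ x i < 1) ∧ ∀ k, (b k : ℝ) = ∑ i, x i * (γ i k : ℝ)}

theorem cellSet_finite {d : ℕ} (γ : Fin d → Lattice d) : (cellSet γ).Finite := by
  refine (Set.finite_Icc (fun k => -∑ i, |γ i k|) (fun k => ∑ i, |γ i k|)).subset ?_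
  rintro b ⟨x, hx, hb⟩
  have key : ∀ k, |b k| ≤ ∑ i, |γ i k| := by
    intro k
    have h : |(b k : ℝ)| ≤ ∑ i, |(γ i k : ℝ)| := by
      rw [hb k]
      refine (Finset.abs_sum_le_sum_abs _ _).trans (Finset.sum_le_sum fun i _ => ?_)
      rw [abs_mul, abs_of_nonneg (hx i).1]
      exact mul_le_of_le_one_left (abs_nonneg _) (hx i).2.le
    exact_mod_cast h
  exact ⟨fun k => (abs_le.mp (key k)).1, fun k => (abs_le.mp (key k)).2⟩

/-- The primitive cell `B`, as a finite set. -/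
def cell {d : ℕ} (γ : Fin d → Lattice d) : Finset (Lattice d) := (cellSet_finite γ).toFinset

/-- The box `Λ = ⋃_{-n ≤ n_i ≤ n} (B + ∑ n_i γ_i)`. -/
def box {d : ℕ} (γ : Fin d → Lattice d) (n : ℕ) : Finset (Lattice d) :=
  (Fintype.piFinset fun _ : Fin d => Finset.Icc (-(n : ℤ)) (n : ℤ)).biUnion
    fun m => (cell γ).image fun b => b + ∑ i, m i • γ i

/-! ### Trace per unit volume and DOS functional -/

/-- The subspace `H_Λ` spanned by the `φ_j`, `j ∈ Λ`. -/
def boxSpace {d : ℕ} (Λ : Finset (Lattice d)) : Submodule ℂ (HSpace d) :=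
  Submodule.span ℂ (Set.range fun j : Λ => (basisVec (j : Lattice d) : HSpace d))

instance {d : ℕ} (Λ : Finset (Lattice d)) : FiniteDimensional ℂ (boxSpace Λ) :=
  FiniteDimensional.span_of_finite ℂ (Set.finite_range _)

/-- The orthogonal projection `P_Λ` onto `H_Λ`. -/
def boxProj {d : ℕ} (Λ : Finset (Lattice d)) : Op d := (boxSpace Λ).starProjection

/-- The trace of an operator on `ℓ²(ℤ^d)`, computed in the canonical basis. It is only applied to
finite rank operators. -/
def trace {d : ℕ} (A : Op d) : ℂ := ∑' k : Lattice d, inner ℂ (basisVec k) (A (basisVec k))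

/-- The trace per unit volume `|Λ|⁻¹ tr (P_Λ f(T) P_Λ)`. -/
def tracePerVolume {d : ℕ} (Λ : Finset (Lattice d)) (f : ℂ → ℂ) (T : Op d) : ℂ :=
  (Λ.card : ℂ)⁻¹ * trace (boxProj Λ ∘L holCalc f T ∘L boxProj Λ)

/-- The DOS functional `L(f) = |B|⁻¹ ∑_{b ∈ B} 𝔼 ⟨φ_b, f(T_ω) φ_b⟩`. -/
def dos {d : ℕ} {Ω : Type*} [MeasurableSpace Ω] (P : Measure Ω) (γ : Fin d → Lattice d)
    (T : Ω → Op d) (f : ℂ → ℂ) : ℂ :=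
  ((cell γ).card : ℂ)⁻¹ *
    ∑ b ∈ cell γ, ∫ ω, inner ℂ (basisVec b) (holCalc f (T ω) (basisVec b)) ∂P

/-- The product measure `⨂_{k ∈ ℤ^d} μ` on `X^{ℤ^d}`. -/
def productMeasure (d : ℕ) {X : Set ℝ} (μ : Measure X) : Measure (Lattice d → X) :=
  Measure.infinitePi fun _ : Lattice d => μ

end RandomContraction

end

/-! The diagonal entries of `T ω ^ l` are bounded by 1 and covariant: shifting `ω` by a lattice
vector moves the site by that vector. The translates of the cell by the lattice are disjoint, so the
trace per unit volume of `T ω ^ l` is an average over the cell of ergodic averages of bounded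
functions along the generators, each of which converges almost surely to an expectation. Countably
many exponents produce one set of full measure, and by linearity every polynomial is covered on it.

The passage to the disk algebra is uniform in the operator. Von Neumann's inequality `‖p(T)‖ ≤ sup
|p|` on the unit circle, combined with the uniform continuity of `f` on the closed disk, makes
`f_r(T)` Cauchy in operator norm as `r → 1⁻`, at a rate that depends on `f` alone. So a single
polynomial `p` satisfies `‖f(T) - p(T)‖ ≤ ε` for all contractions `T`
(`exists_polynomial_near_holCalc`). This yields measurability and integrability of the entries of
`f(T ω)`, and an `ε/3` argument carries the convergence from polynomials to all `f` on the same set.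

The two analytic inputs are proved from scratch. The ergodic theorem starts from Birkhoff's theorem
for bounded functions and the ergodicity of every nonzero shift, then goes by induction on the
number of directions. Von Neumann's inequality comes from an isometric embedding that turns a strict
contraction into part of a unitary shift. -/

noncomputable section

namespace RandomContraction

/-! ### Birkhoff's theorem for bounded functions and ergodic maps -/

/-- The running maximum `max_{1 ≤ k ≤ n + 1} ∑_{i < k} F ∘ σ^i` of the Birkhoff sums. -/
def birkhoffMax {Ω : Type*} (σ : Ω → Ω) (F : Ω → ℝ) : ℕ → Ω → ℝ
  | 0, ω => F ω
  | n + 1, ω => F ω + max 0 (birkhoffMax σ F n (σ ω))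

section Birkhoff

variable {Ω : Type*} {σ : Ω → Ω} {F : Ω → ℝ}

theorem birkhoffMax_le_succ (n : ℕ) (ω : Ω) :
    birkhoffMax σ F n ω ≤ birkhoffMax σ F (n + 1) ω := by
  induction n generalizing ω with
  | zero => simp [birkhoffMax]
  | succ n ih =>
    rw [birkhoffMax, birkhoffMax]
    have := ih (σ ω)
    gcongr

theorem monotone_birkhoffMax (ω : Ω) : Monotone fun n => birkhoffMax σ F n ω :=
  monotone_nat_of_le_succ fun n => birkhoffMax_le_succ n ω

theorem birkhoffSum_le_birkhoffMax (n : ℕ) (ω : Ω) :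
    birkhoffSum σ F (n + 1) ω ≤ birkhoffMax σ F n ω := by
  induction n generalizing ω with
  | zero => simp [birkhoffMax]
  | succ n ih =>
    rw [birkhoffSum_succ', birkhoffMax]
    exact add_le_add_right ((ih (σ ω)).trans (le_max_right _ _)) _

theorem abs_birkhoffMax_le {C : ℝ} (hF : ∀ ω, |F ω| ≤ C) (n : ℕ) (ω : Ω) :
    |birkhoffMax σ F n ω| ≤ (n + 1) * C := by
  have hC : 0 ≤ C := (abs_nonneg _).trans (hF ω)
  induction n generalizing ω with
  | zero => simpa [birkhoffMax] using hF ω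
  | succ n ih =>
    rw [birkhoffMax]
    have h1 := abs_le.mp (ih (σ ω))
    have h2 := abs_le.mp (hF ω)
    have h3 : max 0 (birkhoffMax σ F n (σ ω)) ≤ (n + 1) * C := max_le (by positivity) h1.2
    have h4 : 0 ≤ max 0 (birkhoffMax σ F n (σ ω)) := le_max_left _ _
    have h5 : 0 ≤ (n : ℝ) * C := by positivity
    push_cast
    rw [abs_le]
    constructor <;> nlinarith

/-- The recursion `M_{n+1} = F + max 0 (M_n ∘ σ)` transfers upper bounds in both directions. The set
where the maxima stay bounded is thus exactly invariant, as the zero-one law for ergodic maps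
requires. -/
theorem bddAbove_birkhoffMax_comp (ω : Ω) :
    BddAbove (Set.range fun n => birkhoffMax σ F n (σ ω)) ↔
      BddAbove (Set.range fun n => birkhoffMax σ F n ω) := by
  constructor
  · rintro ⟨K, hK⟩
    refine ⟨F ω + max 0 K, ?_⟩
    rintro _ ⟨n, rfl⟩
    refine (birkhoffMax_le_succ n ω).trans ?_
    rw [birkhoffMax]
    have := hK ⟨n, rfl⟩
    dsimp only at this
    gcongr
  · rintro ⟨K, hK⟩
    refine ⟨K - F ω, ?_⟩
    rintro _ ⟨n, rfl⟩
    have := hK ⟨n + 1, rfl⟩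
    simp only [birkhoffMax] at this
    have h2 := le_max_right 0 (birkhoffMax σ F n (σ ω))
    dsimp only
    linarith

variable [MeasurableSpace Ω] {P : Measure Ω}

theorem measurable_birkhoffMax (hσ : Measurable σ) (hF : Measurable F) (n : ℕ) :
    Measurable (birkhoffMax σ F n) := by
  induction n with
  | zero => exact hF
  | succ n ih => exact hF.add (measurable_const.max (ih.comp hσ))

variable [IsProbabilityMeasure P]

theorem integrable_of_abs_le {G : Ω → ℝ} (hG : Measurable G) {C : ℝ} (hC : ∀ ω, |G ω| ≤ C) :
    Integrable G P :=
  Integrable.of_bound hG.aestronglyMeasurable C (Eventually.of_forall hC)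

/-- If the Birkhoff sums of a bounded function are almost surely unbounded above, its integral is
nonnegative. -/
theorem integral_nonneg_of_not_bddAbove (hσ : MeasurePreserving σ P P) (hF : Measurable F) {C : ℝ}
    (hC : ∀ ω, |F ω| ≤ C)
    (h : ∀ᵐ ω ∂P, ¬ BddAbove (Set.range fun n => birkhoffMax σ F n ω)) : 0 ≤ ∫ ω, F ω ∂P := by
  have hM := measurable_birkhoffMax hσ.measurable hF
  have hint : ∀ n, Integrable (birkhoffMax σ F n) P := fun n =>
    integrable_of_abs_le (hM n) (abs_birkhoffMax_le hC n)
  have hintσ : ∀ n, Integrable (fun ω => birkhoffMax σ F n (σ ω)) P := fun n =>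
    integrable_of_abs_le ((hM n).comp hσ.measurable) fun ω => abs_birkhoffMax_le hC n (σ ω)
  -- `M_{n+1} - M_n ∘ σ = F - min 0 (M_n ∘ σ)`, which equals `F` once `M_n ∘ σ ≥ 0`. Since `M_n ∘ σ
  -- ≥ F ∘ σ ≥ -C`, it is dominated by `2 * C`.
  have hlim : Tendsto (fun n => ∫ ω, (birkhoffMax σ F (n + 1) ω - birkhoffMax σ F n (σ ω)) ∂P)
      atTop (𝓝 (∫ ω, F ω ∂P)) := by
    refine tendsto_integral_of_dominated_convergence (fun _ => 2 * C)
      (fun n => ((hM (n + 1)).sub ((hM n).comp hσ.measurable)).aestronglyMeasurable)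
      (integrable_const _) (fun n => Eventually.of_forall fun ω => ?_) ?_
    · have h0 : F (σ ω) ≤ birkhoffMax σ F n (σ ω) := monotone_birkhoffMax (σ ω) (Nat.zero_le n)
      have h1 := abs_le.mp (hC ω)
      have h2 := abs_le.mp (hC (σ ω))
      rw [birkhoffMax, Real.norm_eq_abs, abs_le]
      rcases le_total 0 (birkhoffMax σ F n (σ ω)) with h3 | h3
      · rw [max_eq_right h3]; constructor <;> linarith
      · rw [max_eq_left h3]; constructor <;> linarith
    · filter_upwards [h] with ω hω
      have hω' : ¬ BddAbove (Set.range fun n => birkhoffMax σ F n (σ ω)) := by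
        rwa [bddAbove_birkhoffMax_comp]
      have htop := tendsto_atTop_atTop_of_monotone' (monotone_birkhoffMax (σ ω)) hω'
      refine tendsto_const_nhds.congr' ?_
      filter_upwards [htop.eventually_ge_atTop 0] with n hn
      rw [birkhoffMax, max_eq_right hn]
      ring
  refine ge_of_tendsto' hlim fun n => ?_
  -- By invariance of `P` the integral is that of `M_{n+1} - M_n`, which is nonnegative.
  rw [integral_sub (hint _) (hintσ _)]
  have h1 : ∫ ω, birkhoffMax σ F n (σ ω) ∂P = ∫ ω, birkhoffMax σ F n ω ∂P := by
    rw [← integral_map hσ.measurable.aemeasurable (hσ.map_eq ▸ (hM n).aestronglyMeasurable),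
      hσ.map_eq]
  rw [h1, sub_nonneg]
  exact integral_mono (hint n) (hint (n + 1)) fun ω => birkhoffMax_le_succ n ω

theorem ae_bddAbove_birkhoffSum (hσ : Ergodic σ P) (hF : Measurable F) {C : ℝ}
    (hC : ∀ ω, |F ω| ≤ C) (hneg : ∫ ω, F ω ∂P < 0) :
    ∀ᵐ ω ∂P, BddAbove (Set.range fun n => birkhoffSum σ F (n + 1) ω) := by
  have hmeas : MeasurableSet {ω | BddAbove (Set.range fun n => birkhoffMax σ F n ω)} :=
    measurableSet_bddAbove_range (measurable_birkhoffMax hσ.measurable hF)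
  rcases hσ.toPreErgodic.ae_mem_or_ae_notMem hmeas
    (Set.ext fun ω => bddAbove_birkhoffMax_comp ω) with h | h
  · filter_upwards [h] with ω hω
    obtain ⟨K, hK⟩ := hω
    refine ⟨K, ?_⟩
    rintro _ ⟨n, rfl⟩
    exact (birkhoffSum_le_birkhoffMax n ω).trans (hK ⟨n, rfl⟩)
  · exact absurd (integral_nonneg_of_not_bddAbove hσ.toMeasurePreserving hF hC h) (not_le.mpr hneg)

/-- Subtracting `m + ε / 2` from `F` makes the integral negative, so the recentred sums are bounded
by some `K` depending on `ω`; dividing by `n`, the term `K / n` is eventually at most `ε / 2`. -/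
theorem ae_eventually_birkhoffAverage_le (hσ : Ergodic σ P) (hF : Measurable F) {C : ℝ}
    (hC : ∀ ω, |F ω| ≤ C) {ε : ℝ} (hε : 0 < ε) :
    ∀ᵐ ω ∂P, ∀ᶠ n in atTop, birkhoffAverage ℝ σ F n ω ≤ (∫ ω, F ω ∂P) + ε := by
  set m := ∫ ω, F ω ∂P
  have hint : Integrable F P := integrable_of_abs_le hF hC
  have hneg : ∫ ω, (F ω - (m + ε / 2)) ∂P < 0 := by
    rw [integral_sub hint (integrable_const _)]
    simp only [integral_const, probReal_univ, one_smul]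
    change m - (m + ε / 2) < 0
    linarith
  have hb := ae_bddAbove_birkhoffSum (F := fun ω => F ω - (m + ε / 2)) hσ (hF.sub_const _)
    (C := C + |m + ε / 2|) (fun ω => (abs_sub _ _).trans (by gcongr; exact hC ω)) hneg
  filter_upwards [hb] with ω ⟨K, hK⟩
  have hsum : ∀ n, birkhoffSum σ (fun ω => F ω - (m + ε / 2)) n ω =
      birkhoffSum σ F n ω - n * (m + ε / 2) := fun n => by
    simp [birkhoffSum, Finset.sum_sub_distrib]
    ring
  have hlarge : ∀ᶠ n : ℕ in atTop, K ≤ n * (ε / 2) :=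
    (tendsto_natCast_atTop_atTop.atTop_mul_const (half_pos hε)).eventually_ge_atTop K
  filter_upwards [hlarge, eventually_gt_atTop 0] with n hn hpos
  obtain ⟨k, rfl⟩ : ∃ k, n = k + 1 := ⟨n - 1, by omega⟩
  have h1 := hK ⟨k, rfl⟩
  dsimp only at h1
  rw [hsum] at h1
  have hk : (0 : ℝ) < ((k + 1 : ℕ) : ℝ) := by positivity
  rw [birkhoffAverage, smul_eq_mul, inv_mul_le_iff₀ hk]
  linarith

/-- **Birkhoff's ergodic theorem** for bounded functions. -/
theorem ae_tendsto_birkhoffAverage (hσ : Ergodic σ P) (hF : Measurable F) {C : ℝ}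
    (hC : ∀ ω, |F ω| ≤ C) :
    ∀ᵐ ω ∂P, Tendsto (fun n => birkhoffAverage ℝ σ F n ω) atTop (𝓝 (∫ ω, F ω ∂P)) := by
  -- Tolerances `1 / (k + 1)` keep the exceptional set null; the lower bound is the upper bound for
  -- `-F`.
  have h1 : ∀ᵐ ω ∂P, ∀ k : ℕ, ∀ᶠ n in atTop,
      birkhoffAverage ℝ σ F n ω ≤ (∫ ω, F ω ∂P) + 1 / ((k : ℝ) + 1) :=
    ae_all_iff.mpr fun k => ae_eventually_birkhoffAverage_le hσ hF hC Nat.one_div_pos_of_nat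
  have h2 : ∀ᵐ ω ∂P, ∀ k : ℕ, ∀ᶠ n in atTop,
      birkhoffAverage ℝ σ (-F) n ω ≤ (∫ ω, (-F) ω ∂P) + 1 / ((k : ℝ) + 1) :=
    ae_all_iff.mpr fun k => ae_eventually_birkhoffAverage_le hσ hF.neg (C := C)
      (fun ω => by simpa using hC ω) Nat.one_div_pos_of_nat
  filter_upwards [h1, h2] with ω h1 h2
  rw [Metric.tendsto_nhds]
  intro ε hε
  obtain ⟨k, hk⟩ := exists_nat_one_div_lt hε
  filter_upwards [h1 k, h2 k] with n hn1 hn2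
  rw [birkhoffAverage_neg] at hn2
  simp only [Pi.neg_apply, integral_neg] at hn2
  rw [Real.dist_eq, abs_lt]
  constructor <;> linarith

end Birkhoff

/-! ### The shifts of a product measure are ergodic -/

section Shift

variable {d : ℕ} {X : Type*}

theorem shift_shift (j k : Lattice d) (ω : Lattice d → X) :
    shift j (shift k ω) = shift (j + k) ω := by
  funext m
  simp [shift, add_assoc]

theorem shift_iterate (j : Lattice d) (n : ℕ) (ω : Lattice d → X) :
    (shift j)^[n] ω = shift (n • j) ω := by
  induction n with
  | zero => funext m; simp [shift]
  | succ n ih => rw [Function.iterate_succ_apply', ih, shift_shift, succ_nsmul']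

variable [MeasurableSpace X] (μ : Measure X) [IsProbabilityMeasure μ]

theorem measurable_shift (j : Lattice d) : Measurable (shift j : (Lattice d → X) → _) := by
  unfold shift
  fun_prop

theorem measurePreserving_shift (j : Lattice d) :
    MeasurePreserving (shift j) (Measure.infinitePi fun _ : Lattice d => μ)
      (Measure.infinitePi fun _ : Lattice d => μ) :=
  ⟨measurable_shift j, Measure.map_infinitePi_infinitePi_of_inj (P := fun _ : Lattice d => μ)
    (add_left_injective j)⟩

/-- The multiples of `g` are pairwise distinct, while only finitely many vectors are differences of
points of `I`. -/
theorem exists_disjoint_translate (I : Finset (Lattice d)) {g : Lattice d} (hg : g ≠ 0) :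
    ∃ n : ℕ, Disjoint I (I.image (· + n • g)) := by
  classical
  have hinj : Function.Injective fun n : ℕ => n • g := by
    intro m n h
    obtain ⟨i, hi⟩ := Function.ne_iff.mp hg
    have := congrFun h i
    simp only [Pi.smul_apply, nsmul_eq_mul] at this
    exact_mod_cast mul_right_cancel₀ hi this
  obtain ⟨n, hn⟩ := Infinite.exists_notMem_finset
    ((I ×ˢ I).image (fun p => p.1 - p.2) |>.preimage (fun n : ℕ => n • g) hinj.injOn)
  refine ⟨n, Finset.disjoint_left.mpr fun a ha hb => hn ?_⟩
  obtain ⟨b, hbI, rfl⟩ := Finset.mem_image.mp hb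
  simp only [Finset.mem_preimage, Finset.mem_image, Finset.mem_product, Prod.exists]
  exact ⟨b + n • g, b, ⟨ha, hbI⟩, by simp⟩

/-- Once the translated index set is disjoint from the original, the cylinder and its shifted copy
depend on independent coordinates, so mixing is exact on cylinders. -/
theorem infinitePi_inter_shift_preimage {C : Set (Lattice d → X)}
    (hC : C ∈ measurableCylinders fun _ : Lattice d => X) {g : Lattice d} (hg : g ≠ 0) :
    ∃ n : ℕ, (Measure.infinitePi fun _ : Lattice d => μ).real (C ∩ shift (n • g) ⁻¹' C) =
      (Measure.infinitePi fun _ : Lattice d => μ).real C ^ 2 := by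
  classical
  obtain ⟨I, S, hS, rfl⟩ := (mem_measurableCylinders _).mp hC
  obtain ⟨n, hn⟩ := exists_disjoint_translate I hg
  refine ⟨n, ?_⟩
  have hind := (ProbabilityTheory.iIndepFun_infinitePi (P := fun _ : Lattice d => μ)
    (X := fun _ x => x) fun _ => measurable_id).indepFun_finset I (I.image (· + n • g)) hn
    fun i => measurable_pi_apply i
  -- Relabelling the translated coordinates presents the shifted cylinder as an event over the
  -- translated index set.
  let r : ((I.image (· + n • g) : Finset (Lattice d)) → X) → (I → X) := fun x i =>
    x ⟨i + n • g, Finset.mem_image_of_mem _ i.2⟩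
  have hr : Measurable r := by
    refine measurable_pi_lambda _ fun i => measurable_pi_apply _
  have h := hind.measure_inter_preimage_eq_mul S (r ⁻¹' S) hS (hr hS)
  have h1 : (fun (a : Lattice d → X) (i : I) => a i) ⁻¹' S = cylinder I S := rfl
  have h2 : (fun (a : Lattice d → X) (i : (I.image (· + n • g) : Finset (Lattice d))) => a i) ⁻¹'
      (r ⁻¹' S) = shift (n • g) ⁻¹' cylinder I S := rfl
  rw [h1, h2, (measurePreserving_shift μ (n • g)).measure_preimage
    (MeasurableSet.cylinder I hS).nullMeasurableSet] at h
  rw [Measure.real, h, ENNReal.toReal_mul, sq, Measure.real]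

open scoped symmDiff in
-- An invariant set `A` is approximated by a cylinder `C`. Then `C ∩ S⁻ⁿ C` is also close to `A`,
-- and for suitable `n` its probability is `P(C)²`. Hence `P(A) = P(A)²`.
theorem ergodic_shift {g : Lattice d} (hg : g ≠ 0) :
    Ergodic (shift g) (Measure.infinitePi fun _ : Lattice d => μ) := by
  set P := Measure.infinitePi fun _ : Lattice d => μ with hP
  refine ⟨measurePreserving_shift μ g, ⟨fun A hA hinv => ?_⟩⟩
  have hinv' : ∀ n : ℕ, shift (n • g) ⁻¹' A = A := by
    intro n
    have : (shift (n • g) : (Lattice d → X) → _) = (shift g)^[n] :=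
      funext fun ω => (shift_iterate g n ω).symm
    rw [this, Set.preimage_iterate_eq]
    exact Function.iterate_fixed hinv n
  -- The two estimates `h2` and `h3` cost `2 * ε` each, so the factor 5 has slack.
  have key : ∀ ε : ℝ, 0 < ε → |P.real A - P.real A ^ 2| ≤ 5 * ε := by
    intro ε hε
    obtain ⟨C, hC, hCA⟩ := exists_measure_symmDiff_lt_of_generateFrom_isSetRing (μ := P)
      (C := measurableCylinders fun _ : Lattice d => X) isSetRing_measurableCylinders
      ⟨{Set.univ}, Set.countable_singleton _,
        Set.singleton_subset_iff.mpr (univ_mem_measurableCylinders _), by simp⟩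
      generateFrom_measurableCylinders.symm hA (ENNReal.ofReal_pos.mpr hε)
    have hCm : MeasurableSet C := by
      obtain ⟨I, S, hS, rfl⟩ := (mem_measurableCylinders (α := fun _ : Lattice d => X) _).mp hC
      exact MeasurableSet.cylinder I hS
    have hCA' : P.real (C ∆ A) ≤ ε :=
      ENNReal.toReal_le_of_le_ofReal hε.le hCA.le
    obtain ⟨n, hn⟩ := infinitePi_inter_shift_preimage μ hC hg
    have hS := measurePreserving_shift μ (n • g)
    rw [← hP] at hS hn
    have hpre : P.real (shift (n • g) ⁻¹' (C ∆ A)) ≤ ε := by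
      rw [Measure.real, hS.measure_preimage (hCm.symmDiff hA).nullMeasurableSet]
      exact hCA'
    have h1 : |P.real C - P.real A| ≤ ε :=
      (abs_measureReal_sub_le_measureReal_symmDiff hCm.nullMeasurableSet
        hA.nullMeasurableSet).trans hCA'
    have h2 : |P.real (C ∩ shift (n • g) ⁻¹' C) - P.real A| ≤ 2 * ε := by
      refine (abs_measureReal_sub_le_measureReal_symmDiff
        (hCm.inter (hCm.preimage hS.measurable)).nullMeasurableSet hA.nullMeasurableSet).trans ?_
      have hsub : (C ∩ shift (n • g) ⁻¹' C) ∆ A ⊆ (C ∆ A) ∪ shift (n • g) ⁻¹' (C ∆ A) := by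
        intro ω hω
        have hiff : shift (n • g) ω ∈ A ↔ ω ∈ A := by
          rw [← Set.mem_preimage, hinv' n]
        simp only [Set.mem_symmDiff, Set.mem_union, Set.mem_inter_iff, Set.mem_preimage] at hω ⊢
        tauto
      calc P.real ((C ∩ shift (n • g) ⁻¹' C) ∆ A)
          ≤ P.real ((C ∆ A) ∪ shift (n • g) ⁻¹' (C ∆ A)) := measureReal_mono hsub
        _ ≤ P.real (C ∆ A) + P.real (shift (n • g) ⁻¹' (C ∆ A)) := measureReal_union_le _ _
        _ ≤ 2 * ε := by linarith
    rw [hn] at h2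
    have h3 : |P.real C ^ 2 - P.real A ^ 2| ≤ 2 * ε := by
      have ha : P.real A ≤ 1 := measureReal_le_one
      have hc : P.real C ≤ 1 := measureReal_le_one
      have ha0 : 0 ≤ P.real A := measureReal_nonneg
      have hc0 : 0 ≤ P.real C := measureReal_nonneg
      rw [sq_sub_sq, abs_mul, abs_of_nonneg (add_nonneg hc0 ha0)]
      exact mul_le_mul (by linarith) h1 (abs_nonneg _) (by norm_num)
    have h4 := abs_le.mp h2
    have h5 := abs_le.mp h3
    rw [abs_le]
    constructor <;> linarith
  have hzero : P.real A - P.real A ^ 2 = 0 := by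
    rw [← abs_nonpos_iff]
    refine le_of_forall_pos_le_add fun ε hε => ?_
    have := key (ε / 5) (by positivity)
    linarith
  have hcases : P.real A = 0 ∨ P.real A = 1 := by
    have : P.real A * (1 - P.real A) = 0 := by linarith
    rcases mul_eq_zero.mp this with h | h
    · exact Or.inl h
    · exact Or.inr (by linarith)
  rw [eventuallyConst_set']
  rcases hcases with h | h
  · left
    exact ae_eq_empty.mpr ((measureReal_eq_zero_iff).mp h)
  · right
    rw [ae_eq_univ, ← measureReal_eq_zero_iff, measureReal_compl hA, h]
    simp

end Shift

/-! ### The ergodic theorem for averages over parallelepipeds -/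

section BoxAverage

variable {d : ℕ} {X : Type*}

theorem card_Icc_neg_self (n : ℕ) : (Finset.Icc (-(n : ℤ)) n).card = 2 * n + 1 := by
  rw [Int.card_Icc]
  omega

/-- The average of `F` along `∑ i, m i • τ i`, where `-n ≤ m i ≤ n`. -/
noncomputable def boxAverage {k : ℕ} (τ : Fin k → Lattice d) (n : ℕ) (F : (Lattice d → X) → ℝ)
    (ω : Lattice d → X) : ℝ :=
  ((2 * (n : ℝ) + 1) ^ k)⁻¹ * ∑ m ∈ Fintype.piFinset fun _ : Fin k => Finset.Icc (-(n : ℤ)) n,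
    F (shift (∑ i, m i • τ i) ω)

/-- The average of `F` along `m • g`, where `-n ≤ m ≤ n`. -/
noncomputable def segmentAverage (g : Lattice d) (n : ℕ) (F : (Lattice d → X) → ℝ)
    (ω : Lattice d → X) : ℝ :=
  (2 * (n : ℝ) + 1)⁻¹ * ∑ m ∈ Finset.Icc (-(n : ℤ)) n, F (shift (m • g) ω)

theorem sum_piFinset_succ {k : ℕ} {α M : Type*} [AddCommMonoid M] (s : Finset α)
    (G : (Fin (k + 1) → α) → M) :
    ∑ m ∈ Fintype.piFinset fun _ : Fin (k + 1) => s, G m =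
      ∑ m ∈ Fintype.piFinset fun _ : Fin k => s, ∑ x ∈ s, G (Fin.cons x m) := by
  rw [Finset.sum_sigma']
  refine Finset.sum_nbij' (fun m => ⟨Fin.tail m, m 0⟩) (fun p => Fin.cons p.2 p.1) ?_ ?_ ?_ ?_ ?_
  · intro m hm
    simp only [Fintype.mem_piFinset, Finset.mem_sigma] at hm ⊢
    exact ⟨fun i => hm i.succ, hm 0⟩
  · rintro ⟨m, x⟩ h
    simp only [Fintype.mem_piFinset, Finset.mem_sigma] at h ⊢
    exact fun i => Fin.cases h.2 h.1 i
  · intro m _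
    exact Fin.cons_self_tail m
  · rintro ⟨m, x⟩ _
    simp
  · intro m _
    simp [Fin.cons_self_tail]

theorem boxAverage_succ {k : ℕ} (τ : Fin (k + 1) → Lattice d) (n : ℕ) (F : (Lattice d → X) → ℝ)
    (ω : Lattice d → X) :
    boxAverage τ n F ω = boxAverage (Fin.tail τ) n (segmentAverage (τ 0) n F) ω := by
  simp only [boxAverage, segmentAverage, sum_piFinset_succ, ← Finset.mul_sum, shift_shift,
    Fin.sum_univ_succ, Fin.cons_zero, Fin.cons_succ, Fin.tail]
  rw [pow_succ, mul_inv, mul_assoc]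

theorem boxAverage_mono {k : ℕ} (τ : Fin k → Lattice d) (n : ℕ) {F G : (Lattice d → X) → ℝ}
    (h : ∀ ω, F ω ≤ G ω) (ω : Lattice d → X) : boxAverage τ n F ω ≤ boxAverage τ n G ω := by
  unfold boxAverage
  gcongr
  exact h _

theorem boxAverage_sub_const {k : ℕ} (τ : Fin k → Lattice d) (n : ℕ) (F : (Lattice d → X) → ℝ)
    (c : ℝ) (ω : Lattice d → X) :
    boxAverage τ n (fun ω => F ω - c) ω = boxAverage τ n F ω - c := by
  have hn : (2 * (n : ℝ) + 1) ^ k ≠ 0 := by positivity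
  have hcard : (((Fintype.piFinset fun _ : Fin k => Finset.Icc (-(n : ℤ)) n).card : ℕ) : ℝ) =
      (2 * (n : ℝ) + 1) ^ k := by
    simp [Fintype.card_piFinset, card_Icc_neg_self, -Int.card_Icc]
  unfold boxAverage
  rw [Finset.sum_sub_distrib, Finset.sum_const, nsmul_eq_mul, hcard, mul_sub,
    inv_mul_cancel_left₀ hn]

theorem abs_boxAverage_le {k : ℕ} (τ : Fin k → Lattice d) (n : ℕ) (F : (Lattice d → X) → ℝ)
    (ω : Lattice d → X) : |boxAverage τ n F ω| ≤ boxAverage τ n (fun ω => |F ω|) ω := by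
  unfold boxAverage
  rw [abs_mul, abs_of_nonneg (a := ((2 * (n : ℝ) + 1) ^ k)⁻¹) (by positivity)]
  gcongr
  exact Finset.abs_sum_le_sum_abs _ _

theorem sum_Icc_neg_self (a : ℤ → ℝ) (n : ℕ) :
    ∑ m ∈ Finset.Icc (-(n : ℤ)) n, a m =
      ∑ i ∈ Finset.range (n + 1), a i + ∑ i ∈ Finset.range (n + 1), a (-i) - a 0 := by
  induction n with
  | zero => simp
  | succ n ih =>
    have h : Finset.Icc (-((n + 1 : ℕ) : ℤ)) ((n + 1 : ℕ) : ℤ) =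
        insert ((n + 1 : ℕ) : ℤ) (insert (-((n + 1 : ℕ) : ℤ)) (Finset.Icc (-(n : ℤ)) n)) := by
      ext m
      simp only [Finset.mem_Icc, Finset.mem_insert]
      omega
    rw [h, Finset.sum_insert, Finset.sum_insert, ih, Finset.sum_range_succ _ (n + 1),
      Finset.sum_range_succ _ (n + 1)]
    · ring
    · simp
    · simp only [Finset.mem_Icc, Finset.mem_insert]
      omega

/-- A two-sided average combines the forward averages of the shifts by `g` and `-g`; the site `0` is
counted twice, hence the correction term. -/
theorem segmentAverage_eq (g : Lattice d) (n : ℕ) (F : (Lattice d → X) → ℝ) (ω : Lattice d → X) :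
    segmentAverage g n F ω = ((n : ℝ) + 1) / (2 * n + 1) *
      (birkhoffAverage ℝ (shift g) F (n + 1) ω + birkhoffAverage ℝ (shift (-g)) F (n + 1) ω) -
      F ω / (2 * n + 1) := by
  have hn : (n : ℝ) + 1 ≠ 0 := by positivity
  have h0 : shift (0 : Lattice d) ω = ω := by funext m; simp [shift]
  rw [segmentAverage, sum_Icc_neg_self (fun m => F (shift (m • g) ω))]
  simp only [birkhoffAverage, birkhoffSum, shift_iterate, smul_eq_mul, natCast_zsmul, neg_smul,
    zero_smul, h0, smul_neg]
  push_cast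
  field_simp

theorem abs_segmentAverage_le (g : Lattice d) (n : ℕ) {F : (Lattice d → X) → ℝ} {C : ℝ}
    (hC : ∀ ω, |F ω| ≤ C) (ω : Lattice d → X) : |segmentAverage g n F ω| ≤ C := by
  have hn : (0 : ℝ) < 2 * n + 1 := by positivity
  rw [segmentAverage, abs_mul, abs_of_pos (inv_pos.mpr hn), inv_mul_le_iff₀ hn]
  refine (Finset.abs_sum_le_sum_abs _ _).trans ((Finset.sum_le_card_nsmul _ _ C
    fun m _ => hC _).trans_eq ?_)
  rw [card_Icc_neg_self, nsmul_eq_mul]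
  push_cast
  ring

variable [MeasurableSpace X] (μ : Measure X) [IsProbabilityMeasure μ]

theorem ae_tendsto_segmentAverage {g : Lattice d} (hg : g ≠ 0) {F : (Lattice d → X) → ℝ}
    (hF : Measurable F) {C : ℝ} (hC : ∀ ω, |F ω| ≤ C) :
    ∀ᵐ ω ∂(Measure.infinitePi fun _ : Lattice d => μ),
      Tendsto (fun n => segmentAverage g n F ω) atTop
        (𝓝 (∫ ω, F ω ∂(Measure.infinitePi fun _ : Lattice d => μ))) := by
  filter_upwards [ae_tendsto_birkhoffAverage (ergodic_shift μ hg) hF hC,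
    ae_tendsto_birkhoffAverage (ergodic_shift μ (neg_ne_zero.mpr hg)) hF hC] with ω h1 h2
  simp only [segmentAverage_eq]
  have hinv : Tendsto (fun n : ℕ => (2 * (n : ℝ) + 1)⁻¹) atTop (𝓝 0) := by
    refine tendsto_inv_atTop_zero.comp (tendsto_atTop_add_const_right _ _ ?_)
    exact tendsto_natCast_atTop_atTop.const_mul_atTop two_pos
  have hhalf : Tendsto (fun n : ℕ => ((n : ℝ) + 1) / (2 * n + 1)) atTop (𝓝 (1 / 2)) := by
    have h : Tendsto (fun n : ℕ => 1 / 2 + (1 / 2) * (2 * (n : ℝ) + 1)⁻¹) atTop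
        (𝓝 (1 / 2 + (1 / 2) * 0)) := tendsto_const_nhds.add (hinv.const_mul _)
    rw [mul_zero, add_zero] at h
    refine h.congr fun n => ?_
    have : (2 * (n : ℝ) + 1) ≠ 0 := by positivity
    field_simp
    ring
  have hlim := (hhalf.mul (((tendsto_add_atTop_iff_nat 1).mpr h1).add
    ((tendsto_add_atTop_iff_nat 1).mpr h2))).sub (hinv.const_mul (F ω))
  convert hlim using 2 <;> ring

theorem measurable_segmentAverage (g : Lattice d) (n : ℕ) {F : (Lattice d → X) → ℝ}
    (hF : Measurable F) : Measurable (segmentAverage g n F) := by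
  unfold segmentAverage
  exact (Finset.measurable_sum _ fun m _ => hF.comp (measurable_shift _)).const_mul _

/-- **Multidimensional ergodic theorem** for bounded functions on a product space. -/
theorem ae_tendsto_boxAverage {k : ℕ} (τ : Fin (k + 1) → Lattice d) (hτ : ∀ i, τ i ≠ 0)
    {F : (Lattice d → X) → ℝ} (hF : Measurable F) {C : ℝ} (hC : ∀ ω, |F ω| ≤ C) :
    ∀ᵐ ω ∂(Measure.infinitePi fun _ : Lattice d => μ),
      Tendsto (fun n => boxAverage τ n F ω) atTop
        (𝓝 (∫ ω, F ω ∂(Measure.infinitePi fun _ : Lattice d => μ))) := by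
  set P := Measure.infinitePi fun _ : Lattice d => μ with hP
  induction k generalizing F C with
  | zero =>
    filter_upwards [ae_tendsto_segmentAverage μ (hτ 0) hF hC] with ω hω
    refine hω.congr fun n => ?_
    have h0 : shift (0 : Lattice d) ω = ω := by funext m; simp [shift]
    rw [boxAverage_succ, boxAverage]
    simp [h0]
  | succ k ih =>
    set c := ∫ ω, F ω ∂P
    have hA := fun n => measurable_segmentAverage (τ 0) n hF
    -- In the iterated average both the outer average and the inner function depend on `n`. The tail
    -- supremum `G N` dominates the inner deviation for all `n ≥ N`, so the induction hypothesis is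
    -- needed only for a fixed function.
    let G : ℕ → (Lattice d → X) → ℝ := fun N ω => ⨆ n, |segmentAverage (τ 0) (N + n) F ω - c|
    have hle : ∀ n ω, |segmentAverage (τ 0) n F ω - c| ≤ C + |c| := fun n ω =>
      (abs_sub _ _).trans (by gcongr; exact abs_segmentAverage_le (τ 0) n hC ω)
    have hbdd : ∀ N ω, BddAbove (Set.range fun n => |segmentAverage (τ 0) (N + n) F ω - c|) := by
      rintro N ω
      refine ⟨C + |c|, ?_⟩
      rintro _ ⟨n, rfl⟩
      exact hle _ ω
    have hGm : ∀ N, Measurable (G N) := fun N =>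
      Measurable.iSup fun n => ((hA (N + n)).sub_const c).abs
    have hG0 : ∀ N ω, 0 ≤ G N ω := fun N ω => Real.iSup_nonneg fun n => abs_nonneg _
    have hGC : ∀ N ω, |G N ω| ≤ C + |c| := fun N ω => by
      rw [abs_of_nonneg (hG0 N ω)]
      exact ciSup_le fun n => hle _ ω
    have hGlim : Tendsto (fun N => ∫ ω, G N ω ∂P) atTop (𝓝 0) := by
      have h0 : ∫ _, (0 : ℝ) ∂P = 0 := by simp
      rw [← h0]
      refine tendsto_integral_of_dominated_convergence (fun _ => C + |c|)
        (fun N => (hGm N).aestronglyMeasurable) (integrable_const _)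
        (fun N => Eventually.of_forall (hGC N)) ?_
      filter_upwards [ae_tendsto_segmentAverage μ (hτ 0) hF hC] with ω hω
      rw [Metric.tendsto_atTop] at hω ⊢
      intro ε hε
      obtain ⟨N₀, hN₀⟩ := hω (ε / 2) (half_pos hε)
      refine ⟨N₀, fun N hN => ?_⟩
      rw [Real.dist_0_eq_abs, abs_of_nonneg (hG0 N ω)]
      refine (ciSup_le fun n => ?_).trans_lt (half_lt_self hε)
      exact (hN₀ (N + n) (by omega)).le
    have hIH : ∀ᵐ ω ∂P, ∀ N, Tendsto (fun n => boxAverage (Fin.tail τ) n (G N) ω) atTop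
        (𝓝 (∫ ω, G N ω ∂P)) :=
      ae_all_iff.mpr fun N => ih (Fin.tail τ) (fun i => hτ i.succ) (hGm N) (hGC N)
    filter_upwards [hIH] with ω hω
    rw [Metric.tendsto_nhds]
    intro ε hε
    -- Fix `N` with `∫ G N < ε` first; then the outer averages of `G N` eventually drop below `ε`.
    obtain ⟨N, hN⟩ := (hGlim.eventually_lt_const hε).exists
    filter_upwards [(hω N).eventually_lt_const hN, eventually_ge_atTop N] with n hn hnN
    rw [Real.dist_eq, boxAverage_succ, ← boxAverage_sub_const]
    refine (abs_boxAverage_le _ _ _ _).trans_lt (lt_of_le_of_lt ?_ hn)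
    refine boxAverage_mono _ _ (fun ω' => ?_) ω
    obtain ⟨j, rfl⟩ := Nat.exists_eq_add_of_le hnN
    exact le_ciSup (hbdd N ω') j

end BoxAverage

/-! ### Von Neumann's inequality -/

section VonNeumann

open Polynomial

/-- A unitary is normal with spectrum in the unit circle, so the continuous functional calculus
bounds `p(u)` by the supremum of `p` there. -/
theorem norm_aeval_le_of_mem_unitary {A : Type*} [CStarAlgebra A] {u : A} (hu : u ∈ unitary A)
    (p : ℂ[X]) {C : ℝ} (hp : ∀ z : ℂ, ‖z‖ = 1 → ‖p.eval z‖ ≤ C) : ‖aeval u p‖ ≤ C := by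
  have hC : 0 ≤ C := (norm_nonneg _).trans (hp 1 norm_one)
  have hn : IsStarNormal u := ⟨by
    rw [Commute, SemiconjBy, (Unitary.mem_iff.mp hu).1, (Unitary.mem_iff.mp hu).2]⟩
  rw [← cfc_polynomial p u hn]
  refine norm_cfc_le hC fun z hz => hp z ?_
  simpa using spectrum.subset_circle_of_unitary hu hz

variable {H : Type*} [NormedAddCommGroup H]

theorem memℓp_bilateral_shift (m : ℤ) (ψ : lp (fun _ : ℤ => H) 2) :
    Memℓp (fun k : ℤ => (ψ (k + m) : H)) 2 := by
  have h := lp.memℓp ψ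
  rw [memℓp_gen_iff (by norm_num)] at h ⊢
  exact (Equiv.addRight m).summable_iff.mpr h

theorem hasSum_norm_sq (ψ : lp (fun _ : ℤ => H) 2) : HasSum (fun n => ‖ψ n‖ ^ 2) (‖ψ‖ ^ 2) := by
  simpa using lp.hasSum_norm (p := 2) (by norm_num) ψ

variable [InnerProductSpace ℂ H]

/-- The bilateral shift on `ℓ²(ℤ, H)`. -/
def bilateralShift (H : Type*) [NormedAddCommGroup H] [InnerProductSpace ℂ H] :
    lp (fun _ : ℤ => H) 2 ≃ₗᵢ[ℂ] lp (fun _ : ℤ => H) 2 where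
  toFun ψ := ⟨fun k => ψ (k + 1), memℓp_bilateral_shift 1 ψ⟩
  invFun ψ := ⟨fun k => ψ (k + -1), memℓp_bilateral_shift (-1) ψ⟩
  map_add' _ _ := rfl
  map_smul' _ _ := rfl
  left_inv ψ := by
    apply Subtype.ext
    funext k
    exact congrArg ψ (by abel : k + -1 + 1 = k)
  right_inv ψ := by
    apply Subtype.ext
    funext k
    exact congrArg ψ (by abel : k + 1 + -1 = k)
  norm_map' ψ := by
    rw [lp.norm_eq_tsum_rpow (by norm_num), lp.norm_eq_tsum_rpow (by norm_num)]
    congr 1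
    exact (Equiv.addRight (1 : ℤ)).tsum_eq (fun k => ‖(ψ k : H)‖ ^ (2 : ENNReal).toReal)

/-- The bilateral shift as a bounded operator. -/
def bilateralShiftCLM (H : Type*) [NormedAddCommGroup H] [InnerProductSpace ℂ H] :
    lp (fun _ : ℤ => H) 2 →L[ℂ] lp (fun _ : ℤ => H) 2 :=
  (bilateralShift H : lp (fun _ : ℤ => H) 2 →L[ℂ] lp (fun _ : ℤ => H) 2)

theorem bilateralShiftCLM_pow_apply (k : ℕ) (ψ : lp (fun _ : ℤ => H) 2) (n : ℤ) :
    ((bilateralShiftCLM H ^ k) ψ : lp (fun _ : ℤ => H) 2) n = ψ (n + k) := by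
  induction k generalizing n with
  | zero => simp
  | succ k ih =>
    rw [pow_succ']
    change ((bilateralShiftCLM H ^ k) ψ : lp (fun _ : ℤ => H) 2) (n + 1) = _
    rw [ih, show n + 1 + (k : ℤ) = n + ((k + 1 : ℕ) : ℤ) by push_cast; abel]

/-- The sum telescopes to `‖x‖² - ‖Tⁿ x‖²`, and `‖T‖ < 1` kills the remainder. -/
theorem hasSum_norm_defect_sq {T D : H →L[ℂ] H} (hT : ‖T‖ < 1)
    (hD : ∀ x, ‖D x‖ ^ 2 = ‖x‖ ^ 2 - ‖T x‖ ^ 2) (x : H) :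
    HasSum (fun n : ℕ => ‖D ((T ^ n) x)‖ ^ 2) (‖x‖ ^ 2) := by
  rw [hasSum_iff_tendsto_nat_of_nonneg fun _ => by positivity]
  have hsum : ∀ n, ∑ i ∈ Finset.range n, ‖D ((T ^ i) x)‖ ^ 2 = ‖x‖ ^ 2 - ‖(T ^ n) x‖ ^ 2 := by
    intro n
    induction n with
    | zero => simp
    | succ n ih =>
      rw [Finset.sum_range_succ, ih, hD, pow_succ' T n, mul_apply_eq_comp]
      ring
  simp only [hsum]
  have h0 : Tendsto (fun n => (T ^ n) x) atTop (𝓝 0) := by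
    have := ((ContinuousLinearMap.apply ℂ H x).continuous.tendsto 0).comp
      (tendsto_pow_atTop_nhds_zero_of_norm_lt_one hT)
    simpa [Function.comp_def] using this
  simpa using (h0.norm.pow 2).const_sub (‖x‖ ^ 2)

variable [CompleteSpace H]

theorem bilateralShiftCLM_mem_unitary : bilateralShiftCLM H ∈ unitary _ :=
  (Unitary.linearIsometryEquiv.symm (bilateralShift H)).2

/-- A defect operator of a contraction. -/
theorem exists_defect {T : H →L[ℂ] H} (hT : ‖T‖ ≤ 1) :
    ∃ D : H →L[ℂ] H, ∀ x, ‖D x‖ ^ 2 = ‖x‖ ^ 2 - ‖T x‖ ^ 2 := by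
  have hpos : 0 ≤ 1 - star T * T := by
    rw [sub_nonneg]
    refine CStarAlgebra.star_mul_le_algebraMap_norm_sq.trans ?_
    rw [← map_one (algebraMap ℝ (H →L[ℂ] H))]
    exact algebraMap_mono _ (by simpa using hT)
  obtain ⟨D, hD⟩ := CStarAlgebra.nonneg_iff_eq_star_mul_self.mp hpos
  have hsq : ∀ (S : H →L[ℂ] H) x, ((‖S x‖ ^ 2 : ℝ) : ℂ) = inner ℂ x ((star S * S) x) :=
    fun S x => by
      rw [ContinuousLinearMap.star_eq_adjoint, mul_apply_eq_comp,
        ContinuousLinearMap.adjoint_inner_right, inner_self_eq_norm_sq_to_K]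
      simp
  refine ⟨D, fun x => ?_⟩
  have h : ((‖D x‖ ^ 2 : ℝ) : ℂ) = ((‖x‖ ^ 2 - ‖T x‖ ^ 2 : ℝ) : ℂ) := by
    rw [hsq, ← hD, Complex.ofReal_sub, hsq T, sub_apply, inner_sub_right,
      one_apply_eq_self, inner_self_eq_norm_sq_to_K]
    simp
  exact_mod_cast h

theorem aeval_apply_eq_sum {E : Type*} [NormedAddCommGroup E] [NormedSpace ℂ E] (T : E →L[ℂ] E)
    (p : ℂ[X]) (x : E) :
    aeval T p x = ∑ k ∈ Finset.range (p.natDegree + 1), p.coeff k • (T ^ k) x := by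
  rw [aeval_eq_sum_range, sum_apply]
  rfl

/-- With `D` a defect operator, `x ↦ (D Tⁿ x)_{n ≥ 0}`, extended by zero, is an isometry into `ℓ²(ℤ,
H)`. On nonnegative coordinates the bilateral shift `U` acts as `T` does, so `‖p(T) x‖` is at most
`‖p(U) J x‖`, and `U` is unitary. -/
theorem norm_aeval_le_of_norm_lt_one {T : H →L[ℂ] H} (hT : ‖T‖ < 1) (p : ℂ[X]) {C : ℝ}
    (hp : ∀ z : ℂ, ‖z‖ = 1 → ‖p.eval z‖ ≤ C) : ‖aeval T p‖ ≤ C := by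
  have hC : 0 ≤ C := (norm_nonneg _).trans (hp 1 norm_one)
  obtain ⟨D, hD⟩ := exists_defect hT.le
  let j : H → ℤ → H := fun x n => if 0 ≤ n then D ((T ^ n.toNat) x) else 0
  have hj : ∀ x, HasSum (fun n => ‖j x n‖ ^ 2) (‖x‖ ^ 2) := by
    intro x
    refine (Function.Injective.hasSum_iff Nat.cast_injective (f := fun n => ‖j x n‖ ^ 2) ?_).mp ?_
    · intro n hn
      have : ¬ 0 ≤ n := fun h => hn ⟨n.toNat, Int.toNat_of_nonneg h⟩
      simp [j, this]
    · simpa [Function.comp_def, j] using hasSum_norm_defect_sq hT hD x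
  have hjmem : ∀ x, Memℓp (j x) 2 := fun x => by
    rw [memℓp_gen_iff (by norm_num)]
    simpa using (hj x).summable
  let J : H → lp (fun _ : ℤ => H) 2 := fun x => ⟨j x, hjmem x⟩
  have hJ : ∀ x, ‖J x‖ = ‖x‖ := fun x => by
    have h : ‖J x‖ ^ 2 = ‖x‖ ^ 2 := (hasSum_norm_sq (J x)).unique (hj x)
    exact (pow_left_inj₀ (norm_nonneg _) (norm_nonneg _) two_ne_zero).mp h
  refine ContinuousLinearMap.opNorm_le_bound _ hC fun x => ?_
  set U := bilateralShiftCLM H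
  have hcoord : ∀ n : ℕ, (aeval U p (J x) : lp (fun _ : ℤ => H) 2) n =
      D ((T ^ n) (aeval T p x)) := by
    intro n
    rw [aeval_apply_eq_sum, aeval_apply_eq_sum, lp.coeFn_sum, Finset.sum_apply, map_sum, map_sum]
    refine Finset.sum_congr rfl fun k _ => ?_
    rw [lp.coeFn_smul, Pi.smul_apply, bilateralShiftCLM_pow_apply, map_smul, map_smul,
      ← mul_apply_eq_comp (T ^ n), ← pow_add]
    have hpos : (0 : ℤ) ≤ (n : ℤ) + k := by positivity
    have hjk : j x (n + k) = D ((T ^ (n + k)) x) := if_pos hpos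
    exact congrArg (p.coeff k • ·) hjk
  have h1 := hasSum_norm_defect_sq hT hD (aeval T p x)
  -- Only an inequality: `p(U) J x` may have nonzero coordinates at negative indices.
  have h2 : ‖aeval T p x‖ ^ 2 ≤ ‖aeval U p (J x)‖ ^ 2 := by
    refine hasSum_le_inj (fun n : ℕ => (n : ℤ)) Nat.cast_injective (fun _ _ => by positivity)
      (fun n => ?_) h1 (hasSum_norm_sq (aeval U p (J x)))
    rw [hcoord]
  calc ‖aeval T p x‖ ≤ ‖aeval U p (J x)‖ := le_of_sq_le_sq h2 (norm_nonneg _)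
    _ ≤ ‖aeval U p‖ * ‖J x‖ := ContinuousLinearMap.le_opNorm _ _
    _ ≤ C * ‖x‖ := by
      rw [hJ]
      gcongr
      exact norm_aeval_le_of_mem_unitary bilateralShiftCLM_mem_unitary p hp

/-- **Von Neumann's inequality**. -/
theorem norm_aeval_le {T : H →L[ℂ] H} (hT : ‖T‖ ≤ 1) (p : ℂ[X]) {C : ℝ}
    (hp : ∀ z : ℂ, ‖z‖ = 1 → ‖p.eval z‖ ≤ C) : ‖aeval T p‖ ≤ C := by
  -- The strict case applies to `r • T` with `r < 1`; then `r → 1⁻`.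
  have hcont : Continuous fun r : ℝ => ‖aeval ((r : ℂ) • T) p‖ := by
    refine (p.continuous_aeval.comp ?_).norm
    fun_prop
  have hlim : Tendsto (fun r : ℝ => ‖aeval ((r : ℂ) • T) p‖) (𝓝[<] 1) (𝓝 ‖aeval T p‖) := by
    have := hcont.tendsto 1
    simp only [Complex.ofReal_one, one_smul] at this
    exact this.mono_left nhdsWithin_le_nhds
  refine le_of_tendsto hlim ?_
  filter_upwards [Ioo_mem_nhdsLT (zero_lt_one (α := ℝ))] with r hr
  refine norm_aeval_le_of_norm_lt_one ?_ p hp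
  rw [norm_smul, Complex.norm_real, Real.norm_of_nonneg hr.1.le]
  exact (mul_le_of_le_one_right hr.1.le hT).trans_lt hr.2

end VonNeumann

/-! ### The disk algebra functional calculus of a contraction -/

section Calculus

open Polynomial

variable {f : ℂ → ℂ}

theorem hasSum_taylorCoeff (hf : f ∈ diskAlgebra) {z : ℂ} (hz : ‖z‖ < 1) :
    HasSum (fun n => taylorCoeff f n * z ^ n) (f z) := by
  have h := Complex.hasSum_taylorSeries_on_ball hf.2 (z := z) (by simpa using hz)
  have he : (fun n => taylorCoeff f n * z ^ n) =
      fun n => (n.factorial : ℂ)⁻¹ • (z - 0) ^ n • iteratedDeriv n f 0 := by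
    funext n
    simp only [taylorCoeff, sub_zero, smul_eq_mul]
    ring
  rw [he]
  exact h

theorem summable_taylorCoeff (hf : f ∈ diskAlgebra) {r : ℝ} (hr0 : 0 ≤ r) (hr1 : r < 1) :
    Summable fun n => ‖taylorCoeff f n * (r : ℂ) ^ n‖ :=
  (hasSum_taylorCoeff hf (z := r) (by simpa [abs_of_nonneg hr0] using hr1)).summable.norm

/-- `∑_{n < N} c_n r^n z^n` as a polynomial in `z`. -/
def taylorPoly (f : ℂ → ℂ) (r : ℝ) (N : ℕ) : ℂ[X] :=
  ∑ n ∈ Finset.range N, C (taylorCoeff f n * (r : ℂ) ^ n) * X ^ n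

theorem eval_taylorPoly (r : ℝ) (N : ℕ) (z : ℂ) :
    (taylorPoly f r N).eval z =
      ∑ n ∈ Finset.range N, (taylorCoeff f n * (r : ℂ) ^ n) * z ^ n := by
  simp [taylorPoly, eval_finsetSum]

theorem aeval_taylorPoly {A : Type*} [Ring A] [Algebra ℂ A] (r : ℝ) (N : ℕ) (a : A) :
    aeval a (taylorPoly f r N) =
      ∑ n ∈ Finset.range N, (taylorCoeff f n * (r : ℂ) ^ n) • a ^ n := by
  simp [taylorPoly, Algebra.smul_def]

theorem norm_sub_sum_range_le {E : Type*} [NormedAddCommGroup E] {u : ℕ → E} {s : E}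
    (hu : HasSum u s) {b : ℕ → ℝ} (hb : Summable b) (hub : ∀ n, ‖u n‖ ≤ b n) (N : ℕ) :
    ‖s - ∑ n ∈ Finset.range N, u n‖ ≤ ∑' n, b (n + N) := by
  have h := (hasSum_nat_add_iff' N).mpr hu
  rw [← h.tsum_eq]
  exact tsum_of_norm_bounded ((summable_nat_add_iff N).mpr hb).hasSum fun n => hub _

variable {d : ℕ}

theorem norm_pow_le_one {T : Op d} (hT : ‖T‖ ≤ 1) (n : ℕ) : ‖T ^ n‖ ≤ 1 := by
  induction n with
  | zero => exact ContinuousLinearMap.norm_id_le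
  | succ n ih =>
    rw [pow_succ]
    exact (norm_mul_le _ _).trans (mul_le_one₀ ih (norm_nonneg _) hT)

/-- A dilated disk algebra function is approximated by its Taylor polynomials, uniformly on the
disk and on all contractions. -/
theorem exists_polynomial_near_dilation (hf : f ∈ diskAlgebra) {r : ℝ} (hr0 : 0 ≤ r) (hr1 : r < 1)
    {ε : ℝ} (hε : 0 < ε) :
    ∃ p : ℂ[X], (∀ T : Op d, ‖T‖ ≤ 1 → ‖dilatedCalc f r T - aeval T p‖ ≤ ε) ∧
      ∀ z : ℂ, ‖z‖ ≤ 1 → ‖f (r * z) - p.eval z‖ ≤ ε := by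
  have hs := summable_taylorCoeff hf hr0 hr1
  obtain ⟨N, hN⟩ := ((tendsto_sum_nat_add fun n =>
    ‖taylorCoeff f n * (r : ℂ) ^ n‖).eventually_lt_const hε).exists
  refine ⟨taylorPoly f r N, fun T hT => ?_, fun z hz => ?_⟩
  · have hb : ∀ n, ‖(taylorCoeff f n * (r : ℂ) ^ n) • T ^ n‖ ≤
        ‖taylorCoeff f n * (r : ℂ) ^ n‖ := fun n => by
      rw [norm_smul]
      exact mul_le_of_le_one_right (norm_nonneg _) (norm_pow_le_one hT n)
    rw [aeval_taylorPoly]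
    exact (norm_sub_sum_range_le (Summable.of_norm_bounded hs hb).hasSum hs hb N).trans hN.le
  · have hb : ∀ n, ‖(taylorCoeff f n * (r : ℂ) ^ n) * z ^ n‖ ≤
        ‖taylorCoeff f n * (r : ℂ) ^ n‖ := fun n => by
      rw [norm_mul _ (z ^ n), norm_pow]
      exact mul_le_of_le_one_right (norm_nonneg _) (pow_le_one₀ (norm_nonneg _) hz)
    have hz' : ‖(r : ℂ) * z‖ < 1 := by
      rw [norm_mul, Complex.norm_real, Real.norm_of_nonneg hr0]
      exact (mul_le_of_le_one_right hr0 hz).trans_lt hr1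
    have hsum := hasSum_taylorCoeff hf hz'
    simp only [mul_pow, ← mul_assoc] at hsum
    rw [eval_taylorPoly]
    exact (norm_sub_sum_range_le hsum hs hb N).trans hN.le

/-- Von Neumann's inequality for `f_r - f_s`: polynomial approximants, good both on the disk and on
operators, reduce it to the polynomial case. -/
theorem norm_dilatedCalc_sub_le (hf : f ∈ diskAlgebra) {r s : ℝ} (hr0 : 0 ≤ r) (hr1 : r < 1)
    (hs0 : 0 ≤ s) (hs1 : s < 1) {C : ℝ}
    (hC : ∀ z : ℂ, ‖z‖ ≤ 1 → ‖f (r * z) - f (s * z)‖ ≤ C) {T : Op d} (hT : ‖T‖ ≤ 1) :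
    ‖dilatedCalc f r T - dilatedCalc f s T‖ ≤ C := by
  refine le_of_forall_pos_le_add fun ε hε => ?_
  obtain ⟨p, hpT, hpz⟩ := exists_polynomial_near_dilation (d := d) hf hr0 hr1
    (ε := ε / 4) (by positivity)
  obtain ⟨q, hqT, hqz⟩ := exists_polynomial_near_dilation (d := d) hf hs0 hs1
    (ε := ε / 4) (by positivity)
  have hpq : ‖aeval T (p - q)‖ ≤ C + ε / 2 := by
    refine norm_aeval_le hT _ fun z hz => ?_
    have h : (p - q).eval z = (f (r * z) - f (s * z)) - (f (r * z) - p.eval z) +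
        (f (s * z) - q.eval z) := by rw [eval_sub]; ring
    rw [h]
    have h1 := norm_add_le ((f (r * z) - f (s * z)) - (f (r * z) - p.eval z))
      (f (s * z) - q.eval z)
    have h2 := norm_sub_le (f (r * z) - f (s * z)) (f (r * z) - p.eval z)
    linarith [hC z hz.le, hpz z hz.le, hqz z hz.le]
  have h : dilatedCalc f r T - dilatedCalc f s T = (dilatedCalc f r T - aeval T p) -
      (dilatedCalc f s T - aeval T q) + aeval T (p - q) := by rw [map_sub]; abel
  rw [h]
  have h1 := norm_add_le ((dilatedCalc f r T - aeval T p) - (dilatedCalc f s T - aeval T q))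
    (aeval T (p - q))
  have h2 := norm_sub_le (dilatedCalc f r T - aeval T p) (dilatedCalc f s T - aeval T q)
  linarith [hpT T hT, hqT T hT]

theorem exists_forall_dilation_close (hf : f ∈ diskAlgebra) {ε : ℝ} (hε : 0 < ε) :
    ∃ δ : ℝ, 0 ≤ δ ∧ δ < 1 ∧ ∀ r s : ℝ, δ < r → r < 1 → δ < s → s < 1 →
      ∀ z : ℂ, ‖z‖ ≤ 1 → ‖f (r * z) - f (s * z)‖ ≤ ε := by
  have huc := (isCompact_closedBall (0 : ℂ) 1).uniformContinuousOn_of_continuous hf.1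
  obtain ⟨η, hη, h⟩ := Metric.uniformContinuousOn_iff.mp huc ε hε
  refine ⟨max 0 (1 - η), le_max_left _ _, max_lt one_pos (by linarith),
    fun r s hr hr1 hs hs1 z hz => ?_⟩
  obtain ⟨hr0, hrη⟩ := max_lt_iff.mp hr
  obtain ⟨hs0, hsη⟩ := max_lt_iff.mp hs
  have hmem : ∀ t : ℝ, 0 < t → t < 1 → (t : ℂ) * z ∈ Metric.closedBall (0 : ℂ) 1 := by
    intro t ht0 ht1
    rw [mem_closedBall_zero_iff, norm_mul, Complex.norm_real, Real.norm_of_nonneg ht0.le]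
    exact mul_le_one₀ ht1.le (norm_nonneg _) hz
  rw [← dist_eq_norm]
  refine (h _ (hmem r hr0 hr1) _ (hmem s hs0 hs1) ?_).le
  rw [dist_eq_norm, ← sub_mul, norm_mul, ← Complex.ofReal_sub, Complex.norm_real, Real.norm_eq_abs]
  refine (mul_le_of_le_one_right (abs_nonneg _) hz).trans_lt ?_
  rw [abs_lt]
  constructor <;> linarith

/-- The dilations are Cauchy in operator norm, so the limit exists in norm and a fortiori strongly.
-/
theorem exists_isCalcLimit (hf : f ∈ diskAlgebra) {T : Op d} (hT : ‖T‖ ≤ 1) :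
    ∃ A : Op d, IsCalcLimit f T A := by
  have hc : Cauchy (map (fun r : ℝ => dilatedCalc f r T) (𝓝[<] 1)) := by
    rw [Metric.cauchy_iff]
    refine ⟨inferInstance, fun ε hε => ?_⟩
    obtain ⟨δ, hδ0, hδ1, h⟩ := exists_forall_dilation_close hf (half_pos hε)
    refine ⟨_, image_mem_map (Ioo_mem_nhdsLT hδ1), ?_⟩
    rintro _ ⟨r, hr, rfl⟩ _ ⟨s, hs, rfl⟩
    rw [dist_eq_norm]
    exact (norm_dilatedCalc_sub_le hf (hδ0.trans hr.1.le) hr.2 (hδ0.trans hs.1.le) hs.2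
      (h r s hr.1 hr.2 hs.1 hs.2) hT).trans_lt (half_lt_self hε)
  obtain ⟨A, hA⟩ := CompleteSpace.complete hc
  exact ⟨A, fun ψ => ((ContinuousLinearMap.apply ℂ (HSpace d) ψ).continuous.tendsto A).comp hA⟩

theorem isCalcLimit_holCalc (hf : f ∈ diskAlgebra) {T : Op d} (hT : ‖T‖ ≤ 1) :
    IsCalcLimit f T (holCalc f T) := by
  have h := exists_isCalcLimit hf hT
  rw [holCalc, dif_pos h]
  exact h.choose_spec

/-- `f(T)` is approximated by polynomials in `T`, uniformly on all contractions `T`. -/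
theorem exists_polynomial_near_holCalc (hf : f ∈ diskAlgebra) {ε : ℝ} (hε : 0 < ε) :
    ∃ p : ℂ[X], ∀ T : Op d, ‖T‖ ≤ 1 → ‖holCalc f T - aeval T p‖ ≤ ε := by
  obtain ⟨δ, hδ0, hδ1, h⟩ := exists_forall_dilation_close hf (half_pos hε)
  obtain ⟨s, hs⟩ := exists_between hδ1
  obtain ⟨p, hp, -⟩ := exists_polynomial_near_dilation (d := d) hf (hδ0.trans hs.1.le) hs.2
    (half_pos hε)
  refine ⟨p, fun T hT => ?_⟩
  have hlim : ‖holCalc f T - dilatedCalc f s T‖ ≤ ε / 2 := by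
    refine ContinuousLinearMap.opNorm_le_bound _ (by positivity) fun ψ => ?_
    have ht := ((isCalcLimit_holCalc hf hT ψ).sub_const (dilatedCalc f s T ψ)).norm
    refine le_of_tendsto ht ?_
    filter_upwards [Ioo_mem_nhdsLT hδ1] with r hr
    rw [← sub_apply]
    exact ContinuousLinearMap.le_of_opNorm_le _ (norm_dilatedCalc_sub_le hf (hδ0.trans hr.1.le)
      hr.2 (hδ0.trans hs.1.le) hs.2 (h r s hr.1 hr.2 hs.1 hs.2) hT) ψ
  calc ‖holCalc f T - aeval T p‖
      ≤ ‖holCalc f T - dilatedCalc f s T‖ + ‖dilatedCalc f s T - aeval T p‖ :=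
        norm_sub_le_norm_sub_add_norm_sub _ _ _
    _ ≤ ε := by linarith [hp T hT]

end Calculus

/-! ### Diagonal matrix elements and traces -/

section Diagonal

variable {d : ℕ}

/-- The diagonal matrix element `⟨φ_k, A φ_k⟩`. -/
def diagEntry (A : Op d) (k : Lattice d) : ℂ := inner ℂ (basisVec k) (A (basisVec k))

theorem inner_basisVec (k : Lattice d) (ψ : HSpace d) : inner ℂ (basisVec k) ψ = ψ k := by
  rw [basisVec, lp.inner_single_left]
  simp

theorem norm_basisVec (k : Lattice d) : ‖(basisVec k : HSpace d)‖ = 1 := by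
  rw [basisVec, lp.norm_single (by norm_num), norm_one]

theorem norm_diagEntry_le (A : Op d) (k : Lattice d) : ‖diagEntry A k‖ ≤ ‖A‖ := by
  refine (norm_inner_le_norm _ _).trans ?_
  rw [norm_basisVec, one_mul]
  simpa [norm_basisVec] using A.le_opNorm (basisVec k)

theorem diagEntry_sub (A A' : Op d) (k : Lattice d) :
    diagEntry (A - A') k = diagEntry A k - diagEntry A' k := by
  rw [diagEntry, sub_apply, inner_sub_right]
  rfl

theorem boxProj_basisVec_of_mem {Λ : Finset (Lattice d)} {k : Lattice d} (hk : k ∈ Λ) :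
    boxProj Λ (basisVec k) = basisVec k :=
  Submodule.starProjection_eq_self_iff.mpr (Submodule.subset_span ⟨⟨k, hk⟩, rfl⟩)

theorem boxProj_basisVec_of_notMem {Λ : Finset (Lattice d)} {k : Lattice d} (hk : k ∉ Λ) :
    boxProj Λ (basisVec k) = 0 := by
  refine (Submodule.starProjection_apply_eq_zero_iff _).mpr ?_
  rw [boxSpace, Submodule.mem_orthogonal]
  intro u hu
  induction hu using Submodule.span_induction with
  | mem u hu =>
    obtain ⟨j, rfl⟩ := hu
    have hjk : (j : Lattice d) ≠ k := fun h => hk (h ▸ j.2)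
    dsimp only
    rw [inner_basisVec, basisVec, lp.single_apply, Pi.single_eq_of_ne hjk]
  | zero => exact inner_zero_left _
  | add u v _ _ hu hv => rw [inner_add_left, hu, hv, add_zero]
  | smul c u _ hu => rw [inner_smul_left, hu, mul_zero]

/-- The projection is self-adjoint and either fixes or kills each basis vector, so the trace series
is a finite sum. -/
theorem trace_boxProj (Λ : Finset (Lattice d)) (A : Op d) :
    trace (boxProj Λ ∘L A ∘L boxProj Λ) = ∑ j ∈ Λ, diagEntry A j := by
  have h : ∀ k, inner ℂ (basisVec k) ((boxProj Λ ∘L A ∘L boxProj Λ) (basisVec k)) =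
      inner ℂ (boxProj Λ (basisVec k)) (A (boxProj Λ (basisVec k))) := fun k =>
    (Submodule.inner_starProjection_left_eq_right _ _ _).symm
  rw [trace, tsum_eq_sum (s := Λ)]
  · refine Finset.sum_congr rfl fun k hk => ?_
    rw [h, boxProj_basisVec_of_mem hk]
    rfl
  · intro k hk
    rw [h, boxProj_basisVec_of_notMem hk, inner_zero_left]

theorem diagEntry_aeval (T : Op d) (p : Polynomial ℂ) (k : Lattice d) :
    diagEntry (Polynomial.aeval T p) k =
      ∑ n ∈ Finset.range (p.natDegree + 1), p.coeff n * diagEntry (T ^ n) k := by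
  rw [diagEntry, aeval_apply_eq_sum, inner_sum]
  exact Finset.sum_congr rfl fun n _ => inner_smul_right _ _ _

theorem norm_inv_card_mul_sum_le {ι : Type*} (s : Finset ι) {a : ι → ℂ} {ε : ℝ} (hε : 0 ≤ ε)
    (ha : ∀ i ∈ s, ‖a i‖ ≤ ε) : ‖(s.card : ℂ)⁻¹ * ∑ i ∈ s, a i‖ ≤ ε := by
  rcases s.eq_empty_or_nonempty with rfl | hs
  · simpa using hε
  · have hpos : (0 : ℝ) < s.card := by exact_mod_cast hs.card_pos
    rw [norm_mul, norm_inv, Complex.norm_natCast, inv_mul_le_iff₀ hpos]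
    exact (norm_sum_le_of_le s ha).trans_eq (by rw [Finset.sum_const, nsmul_eq_mul])

end Diagonal

/-! ### Geometry of the boxes -/

section Boxes

variable {d : ℕ} {γ : Fin d → Lattice d}

/-- Coordinates with respect to the `γ i` are unique, and those of cell points lie in `[0, 1)`. So
the integers `m i` and `m' i` differ by less than 1. -/
theorem eq_of_cell_add_eq (hγ : LinearIndependent ℝ fun i : Fin d => fun k : Fin d => (γ i k : ℝ))
    {b b' : Lattice d} (hb : b ∈ cell γ) (hb' : b' ∈ cell γ) {m m' : Fin d → ℤ}
    (h : b + ∑ i, m i • γ i = b' + ∑ i, m' i • γ i) : m = m' := by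
  obtain ⟨x, hx, hbx⟩ := (cellSet_finite γ).mem_toFinset.mp hb
  obtain ⟨x', hx', hbx'⟩ := (cellSet_finite γ).mem_toFinset.mp hb'
  have hzero := Fintype.linearIndependent_iff.mp hγ (fun i => (x i + m i) - (x' i + m' i)) (by
    funext k
    have hk := congrArg (fun z : ℤ => (z : ℝ)) (congrFun h k)
    simp only [Pi.add_apply, Finset.sum_apply, Pi.smul_apply, smul_eq_mul, Int.cast_add,
      Int.cast_sum, Int.cast_mul, hbx, hbx'] at hk
    simp only [Finset.sum_apply, Pi.smul_apply, smul_eq_mul, sub_mul, add_mul,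
      Finset.sum_sub_distrib, Finset.sum_add_distrib, Pi.zero_apply]
    linarith)
  funext i
  have h0 := hzero i
  have h1 := hx i
  have h2 := hx' i
  have h3 : (m i : ℝ) < m' i + 1 := by linarith
  have h4 : (m' i : ℝ) < m i + 1 := by linarith
  have h5 : m i < m' i + 1 := by exact_mod_cast h3
  have h6 : m' i < m i + 1 := by exact_mod_cast h4
  omega

theorem sum_box (hγ : LinearIndependent ℝ fun i : Fin d => fun k : Fin d => (γ i k : ℝ))
    (n : ℕ) (a : Lattice d → ℂ) :
    ∑ j ∈ box γ n, a j = ∑ b ∈ cell γ,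
      ∑ m ∈ Fintype.piFinset fun _ : Fin d => Finset.Icc (-(n : ℤ)) n,
        a (b + ∑ i, m i • γ i) := by
  rw [box, Finset.sum_biUnion, Finset.sum_comm]
  · exact Finset.sum_congr rfl fun m _ => Finset.sum_image fun b _ b' _ h => add_right_cancel h
  · intro m _ m' _ hne
    refine Finset.disjoint_left.mpr fun j hj hj' => hne ?_
    obtain ⟨b, hb, rfl⟩ := Finset.mem_image.mp hj
    obtain ⟨b', hb', h⟩ := Finset.mem_image.mp hj'
    exact (eq_of_cell_add_eq hγ hb' hb h).symm

theorem card_box (hγ : LinearIndependent ℝ fun i : Fin d => fun k : Fin d => (γ i k : ℝ))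
    (n : ℕ) : ((box γ n).card : ℂ) = (cell γ).card * (2 * (n : ℂ) + 1) ^ d := by
  have h := sum_box hγ n fun _ => 1
  simp only [Finset.sum_const, Fintype.card_piFinset, card_Icc_neg_self, Finset.prod_const,
    Finset.card_univ, Fintype.card_fin, nsmul_eq_mul, mul_one] at h
  rw [h]
  push_cast
  ring

theorem average_box_eq (hγ : LinearIndependent ℝ fun i : Fin d => fun k : Fin d => (γ i k : ℝ))
    (n : ℕ) (a : Lattice d → ℂ) :
    ((box γ n).card : ℂ)⁻¹ * ∑ j ∈ box γ n, a j = ((cell γ).card : ℂ)⁻¹ * ∑ b ∈ cell γ,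
      ((2 * (n : ℂ) + 1) ^ d)⁻¹ *
        ∑ m ∈ Fintype.piFinset fun _ : Fin d => Finset.Icc (-(n : ℤ)) n,
          a (b + ∑ i, m i • γ i) := by
  rw [sum_box hγ, card_box hγ, mul_inv, mul_assoc, Finset.mul_sum]

end Boxes

/-! ### Random operators -/

section RandomOperators

variable {d : ℕ}

/-- Weak measurability survives composition: expanding `x ω` in the countable canonical basis gives
a pointwise limit of finite sums of products of measurable functions. -/
theorem measurable_inner_apply {Ω : Type*} [MeasurableSpace Ω] {T : Ω → Op d}
    (hT : ∀ φ ψ : HSpace d, Measurable fun ω => inner ℂ φ (T ω ψ)) {x : Ω → HSpace d}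
    (hx : ∀ φ : HSpace d, Measurable fun ω => inner ℂ φ (x ω)) (φ : HSpace d) :
    Measurable fun ω => inner ℂ φ (T ω (x ω)) := by
  have hsum : ∀ ω, HasSum (fun k => x ω k * inner ℂ φ (T ω (basisVec k)))
      (inner ℂ φ (T ω (x ω))) := by
    intro ω
    have h := (lp.hasSum_single (p := 2) (by norm_num) (x ω)).mapL (innerSL ℂ φ ∘L T ω)
    have he : (fun k => x ω k * inner ℂ φ (T ω (basisVec k))) =
        fun k => (innerSL ℂ φ ∘L T ω) (lp.single 2 k (x ω k)) := by
      funext k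
      have hk : (lp.single 2 k (x ω k) : HSpace d) = x ω k • basisVec k := by
        rw [basisVec, ← lp.single_smul, smul_eq_mul, mul_one]
      rw [hk, map_smul]
      rfl
    rw [he]
    exact h
  refine measurable_of_tendsto_metrizable' (atTop : Filter (Finset (Lattice d)))
    (f := fun s ω => ∑ k ∈ s, x ω k * inner ℂ φ (T ω (basisVec k)))
    (fun s => Finset.measurable_sum _ fun k _ => ?_) (tendsto_pi_nhds.mpr fun ω => hsum ω)
  refine Measurable.mul ?_ (hT _ _)
  simpa only [inner_basisVec] using hx (basisVec k)

theorem measurable_inner_pow {Ω : Type*} [MeasurableSpace Ω] {T : Ω → Op d}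
    (hT : ∀ φ ψ : HSpace d, Measurable fun ω => inner ℂ φ (T ω ψ)) (n : ℕ) (φ ψ : HSpace d) :
    Measurable fun ω => inner ℂ φ ((T ω ^ n) ψ) := by
  induction n generalizing φ with
  | zero => exact (measurable_const : Measurable fun _ : Ω => inner ℂ φ ψ)
  | succ n ih =>
    simp only [pow_succ', mul_apply_eq_comp]
    exact measurable_inner_apply hT ih φ

theorem measurable_diagEntry_aeval {Ω : Type*} [MeasurableSpace Ω] {T : Ω → Op d}
    (hT : ∀ φ ψ : HSpace d, Measurable fun ω => inner ℂ φ (T ω ψ)) (p : Polynomial ℂ)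
    (k : Lattice d) : Measurable fun ω => diagEntry (Polynomial.aeval (T ω) p) k := by
  simp only [diagEntry_aeval]
  exact Finset.measurable_sum _ fun n _ => (measurable_inner_pow hT n _ _).const_mul _

theorem norm_diagEntry_holCalc_sub_le {f : ℂ → ℂ} {p : Polynomial ℂ} {ε : ℝ}
    (hp : ∀ T : Op d, ‖T‖ ≤ 1 → ‖holCalc f T - Polynomial.aeval T p‖ ≤ ε) {T : Op d}
    (hT : ‖T‖ ≤ 1) (k : Lattice d) :
    ‖diagEntry (holCalc f T) k - diagEntry (Polynomial.aeval T p) k‖ ≤ ε := by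
  rw [← diagEntry_sub]
  exact (norm_diagEntry_le _ k).trans (hp T hT)

theorem measurable_diagEntry_holCalc {Ω : Type*} [MeasurableSpace Ω] {T : Ω → Op d}
    (hT : ∀ φ ψ : HSpace d, Measurable fun ω => inner ℂ φ (T ω ψ)) (hT1 : ∀ ω, ‖T ω‖ ≤ 1)
    {f : ℂ → ℂ} (hf : f ∈ diskAlgebra) (k : Lattice d) :
    Measurable fun ω => diagEntry (holCalc f (T ω)) k := by
  -- The polynomials do not depend on `ω`, so the entries of `f(T ω)` are pointwise limits of
  -- measurable functions.
  choose p hp using fun n : ℕ =>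
    exists_polynomial_near_holCalc (d := d) hf (Nat.one_div_pos_of_nat (α := ℝ) (n := n))
  refine measurable_of_tendsto_metrizable (fun n => measurable_diagEntry_aeval hT (p n) k) ?_
  refine tendsto_pi_nhds.mpr fun ω => tendsto_iff_norm_sub_tendsto_zero.mpr ?_
  refine squeeze_zero (fun _ => norm_nonneg _) (fun n => ?_) tendsto_one_div_add_atTop_nhds_zero_nat
  rw [norm_sub_rev]
  exact norm_diagEntry_holCalc_sub_le (hp n) (hT1 ω) k

theorem norm_diagEntry_pow_le {T : Op d} (hT : ‖T‖ ≤ 1) (n : ℕ) (k : Lattice d) :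
    ‖diagEntry (T ^ n) k‖ ≤ 1 :=
  (norm_diagEntry_le _ k).trans (norm_pow_le_one hT n)

theorem integrable_diagEntry_pow {Ω : Type*} [MeasurableSpace Ω] {T : Ω → Op d}
    (hT : ∀ φ ψ : HSpace d, Measurable fun ω => inner ℂ φ (T ω ψ)) (hT1 : ∀ ω, ‖T ω‖ ≤ 1)
    (P : Measure Ω) [IsProbabilityMeasure P] (n : ℕ) (k : Lattice d) :
    Integrable (fun ω => diagEntry (T ω ^ n) k) P :=
  Integrable.of_bound (measurable_inner_pow hT n _ _).aestronglyMeasurable 1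
    (Eventually.of_forall fun ω => norm_diagEntry_pow_le (hT1 ω) n k)

theorem integrable_diagEntry_aeval {Ω : Type*} [MeasurableSpace Ω] {T : Ω → Op d}
    (hT : ∀ φ ψ : HSpace d, Measurable fun ω => inner ℂ φ (T ω ψ)) (hT1 : ∀ ω, ‖T ω‖ ≤ 1)
    (P : Measure Ω) [IsProbabilityMeasure P] (p : Polynomial ℂ) (k : Lattice d) :
    Integrable (fun ω => diagEntry (Polynomial.aeval (T ω) p) k) P := by
  simp only [diagEntry_aeval]
  exact integrable_finsetSum _ fun n _ => (integrable_diagEntry_pow hT hT1 P n k).const_mul _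

theorem integrable_diagEntry_holCalc {Ω : Type*} [MeasurableSpace Ω] {T : Ω → Op d}
    (hT : ∀ φ ψ : HSpace d, Measurable fun ω => inner ℂ φ (T ω ψ)) (hT1 : ∀ ω, ‖T ω‖ ≤ 1)
    (P : Measure Ω) [IsProbabilityMeasure P] {f : ℂ → ℂ} (hf : f ∈ diskAlgebra) (k : Lattice d) :
    Integrable (fun ω => diagEntry (holCalc f (T ω)) k) P := by
  obtain ⟨p, hp⟩ := exists_polynomial_near_holCalc (d := d) hf one_pos
  have hdiff : Integrable (fun ω => diagEntry (holCalc f (T ω)) k -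
      diagEntry (Polynomial.aeval (T ω) p) k) P :=
    Integrable.of_bound ((measurable_diagEntry_holCalc hT hT1 hf k).sub
      (measurable_diagEntry_aeval hT p k)).aestronglyMeasurable 1
      (Eventually.of_forall fun ω => norm_diagEntry_holCalc_sub_le hp (hT1 ω) k)
  exact (hdiff.add (integrable_diagEntry_aeval hT hT1 P p k)).congr
    (Eventually.of_forall fun ω => sub_add_cancel _ _)

variable {X : Type*}

theorem translation_symm_basisVec (g k : Lattice d) :
    (translation g).symm (basisVec k) = basisVec (k + g) := by
  rw [LinearIsometryEquiv.symm_apply_eq, translation_basisVec, add_sub_cancel_right]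

/-- Conjugation by the translation passes to powers, and the translation carries `basisVec (k + g)`
to `basisVec k`. -/
theorem diagEntry_pow_shift {T : (Lattice d → X) → Op d} {g : Lattice d} {ω : Lattice d → X}
    (h : ∀ ψ : HSpace d, T (shift g ω) ψ = translation g (T ω ((translation g).symm ψ)))
    (n : ℕ) (k : Lattice d) :
    diagEntry (T (shift g ω) ^ n) k = diagEntry (T ω ^ n) (k + g) := by
  have hpow : ∀ ψ, (T (shift g ω) ^ n) ψ =
      translation g ((T ω ^ n) ((translation g).symm ψ)) := by
    induction n with
    | zero => intro ψ; simp
    | succ n ih =>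
      intro ψ
      rw [pow_succ', mul_apply_eq_comp, ih, h, LinearIsometryEquiv.symm_apply_apply, pow_succ',
        mul_apply_eq_comp]
  have hk : (basisVec k : HSpace d) = translation g (basisVec (k + g)) := by
    rw [translation_basisVec, add_sub_cancel_right]
  rw [diagEntry, hpow, translation_symm_basisVec, diagEntry]
  conv_lhs => rw [hk]
  exact LinearIsometryEquiv.inner_map_map _ _ _

variable [MeasurableSpace X] (μ : Measure X) [IsProbabilityMeasure μ]

theorem ae_tendsto_complex_boxAverage {k : ℕ} (τ : Fin (k + 1) → Lattice d) (hτ : ∀ i, τ i ≠ 0)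
    {F : (Lattice d → X) → ℂ} (hF : Measurable F) {C : ℝ} (hC : ∀ ω, ‖F ω‖ ≤ C) :
    ∀ᵐ ω ∂(Measure.infinitePi fun _ : Lattice d => μ),
      Tendsto (fun n : ℕ => ((2 * (n : ℂ) + 1) ^ (k + 1))⁻¹ *
        ∑ m ∈ Fintype.piFinset fun _ : Fin (k + 1) => Finset.Icc (-(n : ℤ)) n,
          F (shift (∑ i, m i • τ i) ω)) atTop
        (𝓝 (∫ ω, F ω ∂(Measure.infinitePi fun _ : Lattice d => μ))) := by
  have hint : Integrable F (Measure.infinitePi fun _ : Lattice d => μ) :=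
    Integrable.of_bound hF.aestronglyMeasurable C (Eventually.of_forall hC)
  filter_upwards [ae_tendsto_boxAverage μ τ hτ (F := fun ω => (F ω).re)
      (Complex.measurable_re.comp hF) fun ω => (Complex.abs_re_le_norm _).trans (hC ω),
    ae_tendsto_boxAverage μ τ hτ (F := fun ω => (F ω).im)
      (Complex.measurable_im.comp hF) fun ω => (Complex.abs_im_le_norm _).trans (hC ω)]
    with ω h1 h2
  have h1' := (Complex.continuous_ofReal.tendsto _).comp h1
  have h2' := ((Complex.continuous_ofReal.tendsto _).comp h2).mul_const Complex.I
  have hlim := h1'.add h2'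
  have hre := integral_re hint
  have him := integral_im hint
  simp only [RCLike.re_eq_complex_re, RCLike.im_eq_complex_im] at hre him
  rw [hre, him, Complex.re_add_im] at hlim
  refine hlim.congr fun n => ?_
  simp only [Function.comp_apply, boxAverage]
  push_cast
  rw [mul_assoc, ← mul_add, Finset.sum_mul, ← Finset.sum_add_distrib]
  simp only [Complex.re_add_im]

end RandomOperators

/-! ### Existence of the density of states -/

section DensityOfStates

variable {d : ℕ} {X : Type*} [MeasurableSpace X] {μ : Measure X} [IsProbabilityMeasure μ]
  {γ : Fin d → Lattice d} {T : (Lattice d → X) → Op d}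

/-- Covariance rewrites the entries over the box as values along lattice shifts of one function per
cell point, to which the multidimensional ergodic theorem applies. -/
theorem ae_tendsto_average_pow (hd : 0 < d)
    (hγ : LinearIndependent ℝ fun i : Fin d => fun k : Fin d => (γ i k : ℝ))
    (hT : ∀ φ ψ : HSpace d, Measurable fun ω => inner ℂ φ (T ω ψ)) (hT1 : ∀ ω, ‖T ω‖ ≤ 1)
    (herg : ∀ g ∈ periodLattice γ, ∀ ω, ∀ ψ : HSpace d,
      T (shift g ω) ψ = translation g (T ω ((translation g).symm ψ))) (l : ℕ) :
    ∀ᵐ ω ∂(Measure.infinitePi fun _ : Lattice d => μ),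
      Tendsto (fun n => ((box γ n).card : ℂ)⁻¹ * ∑ j ∈ box γ n, diagEntry (T ω ^ l) j) atTop
        (𝓝 (((cell γ).card : ℂ)⁻¹ * ∑ b ∈ cell γ,
          ∫ ω, diagEntry (T ω ^ l) b ∂(Measure.infinitePi fun _ : Lattice d => μ))) := by
  have hγ0 : ∀ i, γ i ≠ 0 := fun i h => hγ.ne_zero i (by funext k; simp [h])
  have hb : ∀ᵐ ω ∂(Measure.infinitePi fun _ : Lattice d => μ), ∀ b ∈ cell γ,
      Tendsto (fun n : ℕ => ((2 * (n : ℂ) + 1) ^ d)⁻¹ *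
        ∑ m ∈ Fintype.piFinset fun _ : Fin d => Finset.Icc (-(n : ℤ)) n,
          diagEntry (T (shift (∑ i, m i • γ i) ω) ^ l) b) atTop
        (𝓝 (∫ ω, diagEntry (T ω ^ l) b ∂(Measure.infinitePi fun _ : Lattice d => μ))) := by
    refine (ae_ball_iff (cell γ).countable_toSet).mpr fun b _ => ?_
    obtain ⟨k, rfl⟩ : ∃ k, d = k + 1 := ⟨d - 1, by omega⟩
    exact ae_tendsto_complex_boxAverage μ γ hγ0 (F := fun ω => diagEntry (T ω ^ l) b)
      (measurable_inner_pow hT l _ _) fun ω => norm_diagEntry_pow_le (hT1 ω) l b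
  filter_upwards [hb] with ω hω
  refine ((tendsto_finsetSum _ hω).const_mul _).congr fun n => ?_
  rw [average_box_eq hγ]
  congr 1
  refine Finset.sum_congr rfl fun b _ => ?_
  congr 1
  refine Finset.sum_congr rfl fun m _ => ?_
  refine diagEntry_pow_shift (herg _ ?_ ω) l b
  exact sum_mem fun i _ => zsmul_mem (AddSubgroup.subset_closure (Set.mem_range_self i)) _

/-- The exceptional sets of the countably many monomials are discarded together; linearity then
handles all polynomials at once. -/
theorem ae_tendsto_average_aeval (hd : 0 < d)
    (hγ : LinearIndependent ℝ fun i : Fin d => fun k : Fin d => (γ i k : ℝ))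
    (hT : ∀ φ ψ : HSpace d, Measurable fun ω => inner ℂ φ (T ω ψ)) (hT1 : ∀ ω, ‖T ω‖ ≤ 1)
    (herg : ∀ g ∈ periodLattice γ, ∀ ω, ∀ ψ : HSpace d,
      T (shift g ω) ψ = translation g (T ω ((translation g).symm ψ))) :
    ∀ᵐ ω ∂(Measure.infinitePi fun _ : Lattice d => μ), ∀ p : Polynomial ℂ,
      Tendsto (fun n => ((box γ n).card : ℂ)⁻¹ *
          ∑ j ∈ box γ n, diagEntry (Polynomial.aeval (T ω) p) j) atTop
        (𝓝 (((cell γ).card : ℂ)⁻¹ * ∑ b ∈ cell γ, ∫ ω, diagEntry (Polynomial.aeval (T ω) p) b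
          ∂(Measure.infinitePi fun _ : Lattice d => μ))) := by
  filter_upwards [ae_all_iff.mpr (ae_tendsto_average_pow (μ := μ) hd hγ hT hT1 herg)]
    with ω hω p
  have hlim := tendsto_finsetSum (Finset.range (p.natDegree + 1)) fun l _ =>
    (hω l).const_mul (p.coeff l)
  have hswap : ∀ (s : Finset (Lattice d)) (a : ℕ → Lattice d → ℂ),
      (s.card : ℂ)⁻¹ * ∑ j ∈ s, ∑ l ∈ Finset.range (p.natDegree + 1), p.coeff l * a l j =
        ∑ l ∈ Finset.range (p.natDegree + 1), p.coeff l * ((s.card : ℂ)⁻¹ * ∑ j ∈ s, a l j) := by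
    intro s a
    rw [Finset.sum_comm, Finset.mul_sum]
    refine Finset.sum_congr rfl fun l _ => ?_
    rw [← Finset.mul_sum]
    ring
  simp only [diagEntry_aeval]
  have hint : ∀ b, ∫ ω, ∑ l ∈ Finset.range (p.natDegree + 1), p.coeff l * diagEntry (T ω ^ l) b
      ∂(Measure.infinitePi fun _ : Lattice d => μ) =
      ∑ l ∈ Finset.range (p.natDegree + 1), p.coeff l *
        ∫ ω, diagEntry (T ω ^ l) b ∂(Measure.infinitePi fun _ : Lattice d => μ) := by
    intro b
    rw [integral_finsetSum _ fun l _ =>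
      (integrable_diagEntry_pow hT hT1 (Measure.infinitePi fun _ : Lattice d => μ) l b).const_mul _]
    exact Finset.sum_congr rfl fun l _ => integral_const_mul _ _
  simp only [hint, hswap]
  exact hlim

/-- No further null set is lost: `ω` is fixed, and a polynomial within `ε / 3` uniformly over
contractions controls both the box averages and the expectations. -/
theorem tendsto_average_holCalc
    (hT : ∀ φ ψ : HSpace d, Measurable fun ω => inner ℂ φ (T ω ψ)) (hT1 : ∀ ω, ‖T ω‖ ≤ 1)
    {ω : Lattice d → X}
    (hω : ∀ p : Polynomial ℂ,
      Tendsto (fun n => ((box γ n).card : ℂ)⁻¹ *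
          ∑ j ∈ box γ n, diagEntry (Polynomial.aeval (T ω) p) j) atTop
        (𝓝 (((cell γ).card : ℂ)⁻¹ * ∑ b ∈ cell γ, ∫ ω, diagEntry (Polynomial.aeval (T ω) p) b
          ∂(Measure.infinitePi fun _ : Lattice d => μ))))
    {f : ℂ → ℂ} (hf : f ∈ diskAlgebra) :
    Tendsto (fun n => ((box γ n).card : ℂ)⁻¹ * ∑ j ∈ box γ n, diagEntry (holCalc f (T ω)) j) atTop
      (𝓝 (((cell γ).card : ℂ)⁻¹ * ∑ b ∈ cell γ,
        ∫ ω, diagEntry (holCalc f (T ω)) b ∂(Measure.infinitePi fun _ : Lattice d => μ))) := by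
  set P := Measure.infinitePi fun _ : Lattice d => μ
  rw [Metric.tendsto_nhds]
  intro ε hε
  obtain ⟨p, hp⟩ := exists_polynomial_near_holCalc (d := d) hf (ε := ε / 3) (by positivity)
  have havg : ∀ (s : Finset (Lattice d)) (a a' : Lattice d → ℂ), (∀ j, ‖a j - a' j‖ ≤ ε / 3) →
      dist ((s.card : ℂ)⁻¹ * ∑ j ∈ s, a j) ((s.card : ℂ)⁻¹ * ∑ j ∈ s, a' j) ≤ ε / 3 := by
    intro s a a' h
    rw [dist_eq_norm, ← mul_sub, ← Finset.sum_sub_distrib]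
    exact norm_inv_card_mul_sum_le s (by positivity) fun j _ => h j
  have hint : ∀ b, ‖∫ ω, diagEntry (holCalc f (T ω)) b ∂P -
      ∫ ω, diagEntry (Polynomial.aeval (T ω) p) b ∂P‖ ≤ ε / 3 := by
    intro b
    rw [← integral_sub (integrable_diagEntry_holCalc hT hT1 P hf b)
      (integrable_diagEntry_aeval hT hT1 P p b)]
    refine (norm_integral_le_of_norm_le_const (C := ε / 3) (Eventually.of_forall fun ω =>
      norm_diagEntry_holCalc_sub_le hp (hT1 ω) b)).trans_eq ?_
    rw [probReal_univ, mul_one]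
  have h1 := havg (cell γ) _ _ hint
  filter_upwards [Metric.tendsto_nhds.mp (hω p) (ε / 3) (by positivity)] with n hn
  have h2 := havg (box γ n) _ _ fun j => norm_diagEntry_holCalc_sub_le hp (hT1 ω) j
  rw [dist_comm] at h1
  refine (dist_triangle4 _ _ _ _).trans_lt (lt_of_lt_of_eq
    (add_lt_add_of_lt_of_le (add_lt_add_of_le_of_lt h2 hn) h1) ?_)
  ring

end DensityOfStates

end RandomContraction

end

theorem mainTheorem4 {d : ℕ} (hd : 0 < d)
    -- the single-site space `X ⊆ ℝ` and its probability distribution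
    {X : Set ℝ} (μ : MeasureTheory.Measure X) [MeasureTheory.IsProbabilityMeasure μ]
    -- generators of the period lattice
    (γ : Fin d → RandomContraction.Lattice d)
    (hγ : LinearIndependent ℝ (fun i : Fin d => fun k : Fin d => (γ i k : ℝ)))
    -- a measurable random contraction, almost surely completely non unitary
    (T : (RandomContraction.Lattice d → X) → RandomContraction.Op d)
    (hmeas : ∀ φ ψ : RandomContraction.HSpace d,
      Measurable fun ω : RandomContraction.Lattice d → X => inner ℂ φ (T ω ψ))
    (hcontr : ∀ ω, ‖T ω‖ ≤ 1)
    (hcnu : ∀ᵐ ω ∂(RandomContraction.productMeasure d μ), RandomContraction.IsCNU (T ω))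
    -- ergodicity: `T_{S_g ω} = V_g T_ω V_g⁻¹` for all `g ∈ Γ`
    (herg : ∀ g ∈ RandomContraction.periodLattice γ, ∀ ω : RandomContraction.Lattice d → X,
      ∀ ψ : RandomContraction.HSpace d,
        T (RandomContraction.shift g ω) ψ =
          RandomContraction.translation g
            (T ω ((RandomContraction.translation g).symm ψ))) :
    -- the expectations defining `L(f)` exist
    (∀ f ∈ RandomContraction.diskAlgebra, ∀ b ∈ RandomContraction.cell γ,
      MeasureTheory.Integrable
        (fun ω => inner ℂ (RandomContraction.basisVec b)
          (RandomContraction.holCalc f (T ω) (RandomContraction.basisVec b)))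
        (RandomContraction.productMeasure d μ)) ∧
    -- almost surely, for all `f ∈ A(𝔻)`, the operator `f(T_ω)` exists as a strong limit and the
    -- trace per unit volume converges to `L(f)`
    (∀ᵐ ω ∂(RandomContraction.productMeasure d μ), ∀ f ∈ RandomContraction.diskAlgebra,
      RandomContraction.IsCalcLimit f (T ω) (RandomContraction.holCalc f (T ω)) ∧
      Filter.Tendsto
        (fun n : ℕ =>
          RandomContraction.tracePerVolume (RandomContraction.box γ n) f (T ω))
        Filter.atTop
        (nhds (RandomContraction.dos (RandomContraction.productMeasure d μ) γ T f))) := by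
  refine ⟨fun f hf b _ =>
    RandomContraction.integrable_diagEntry_holCalc hmeas hcontr
      (MeasureTheory.Measure.infinitePi fun _ => μ) hf b, ?_⟩
  filter_upwards [RandomContraction.ae_tendsto_average_aeval (μ := μ) hd hγ hmeas hcontr herg]
    with ω hω f hf
  refine ⟨RandomContraction.isCalcLimit_holCalc hf (hcontr ω), ?_⟩
  have h := RandomContraction.tendsto_average_holCalc hmeas hcontr hω hf
  simp only [RandomContraction.tracePerVolume, RandomContraction.trace_boxProj]
  exact h
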